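/- Let $k$ be an algebraically closed field. A finite tensor category over $k$ is a $k$-linear abelian rigid monoidal category with $k$-bilinear tensor product and simple unit object, with finite dimensional morphism spaces, in which every object has finite length, there are finitely many simple objects up to isomorphism, and each simple object has a projective cover. For such a category $\mathcal C$ let $L_i$ ($i\in I$) represent the isomorphism classes of simple objects and let $P_i$ be the projective cover of $L_i$. For an object $X$, its Frobenius–Perron dimension $d_+(X)$ is the largest real eigenvalue of the matrix of left multiplication by $X$ on the Grothendieck ring $Gr(\mathcal C)$, in the basis $(L_i)$. Let $K(\mathcal C)$ be the free abelian group on the isomorphism classes of indecomposable projective objects; every projective object has a class in $K(\mathcal C)$, the sum of its indecomposable summands. Extend $d_+$ linearly to $K(\mathcal C)\otimes_{\mathbb Z}\mathbb C$, and put $$R_{\mathcal C}=\sum_{i\in I} d_+(L_i)\,P_i\in K(\mathcal C)\otimes_{\mathbb Z}\mathbb C,\qquad d_+(\mathcal C)=d_+(R_{\mathcal C}).$$ A functor $F:\mathcal C\to\mathcal D$ between finite tensor categories over $k$ is called quasi-tensor if it is additive, exact and faithful and $F(X)\otimes F(Y)\cong F(X\otimes Y)$ for all objects $X,Y$; it is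 called surjective if every object of $\mathcal D$ is a subquotient of $F(X)$ for some $X\in\mathcal C$. **Theorem (categorical freeness).** Let $F:\mathcal C\to\mathcal D$ be a surjective quasi-tensor functor between finite tensor categories over $k$. 1. $F$ maps projective objects to projective objects (so that it induces a linear map $K(\mathcal C)\otimes\mathbb C\to K(\mathcal D)\otimes\mathbb C$), $d_+(\mathcal D)\neq 0$, and $$F(R_{\mathcal C})=\frac{d_+(\mathcal C)}{d_+(\mathcal D)}\,R_{\mathcal D}.$$ 2. Suppose that $d_+(X)$ is an integer for every object $X$ of $\mathcal C$, so that $R_{\mathcal C}$ is the class of the object $\bigoplus_i P_i^{\oplus d_+(L_i)}$, which is again denoted by $R_{\mathcal C}$. Then $d_+(Y)$ is an integer for every object $Y$ of $\mathcal D$, the number $n=d_+(\mathcal C)/d_+(\mathcal D)$ is a non-negative integer, and $F(R_{\mathcal C})$ is free of rank $n$, i.e. $F(R_{\mathcal C})\cong R_{\mathcal D}^{\oplus n}$. -/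

import Mathlib

open CategoryTheory CategoryTheory.Limits MonoidalCategory

universe w v u v' u'

noncomputable section

attribute [local instance] Abelian.hasFiniteBiproducts

namespace FiniteTensor

section IsoClasses

variable {C : Type u} [Category.{v} C]

/-- The isomorphism relation on the objects of `C` that satisfy `P`. -/
def isoSetoid (P : C → Prop) : Setoid {X : C // P X} where
  r X Y := Nonempty (X.1 ≅ Y.1)
  iseqv := ⟨fun X => ⟨Iso.refl X.1⟩, fun ⟨e⟩ => ⟨e.symm⟩, fun ⟨e⟩ ⟨f⟩ => ⟨e.trans f⟩⟩

/-- Isomorphism classes of objects of `C` that satisfy `P`. -/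
def IsoClass (P : C → Prop) : Type u := Quotient (isoSetoid P)

/-- The isomorphism class of an object satisfying `P`. -/
def IsoClass.mk {P : C → Prop} (X : C) (h : P X) : IsoClass P :=
  Quotient.mk (isoSetoid P) ⟨X, h⟩

/-- A chosen representative of an isomorphism class. -/
def IsoClass.obj {P : C → Prop} (c : IsoClass P) : C :=
  (@Quotient.out _ (isoSetoid P) c).1

theorem IsoClass.obj_prop {P : C → Prop} (c : IsoClass P) : P c.obj :=
  (@Quotient.out _ (isoSetoid P) c).2

end IsoClasses

section Abelian

variable (C : Type u) [Category.{v} C] [Abelian C]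

/-- The set of isomorphism classes of simple objects. -/
abbrev SimpleClass : Type u := IsoClass (fun X : C => Simple X)

/-- The set of isomorphism classes of indecomposable projective objects. -/
abbrev IndecProjClass : Type u := IsoClass (fun X : C => Indecomposable X ∧ Projective X)

variable {C}

/-- `HasFactors X s`: the object `X` has a composition series (a finite filtration with simple
successive quotients) whose multiset of successive quotients, up to isomorphism, is `s`. -/
inductive HasFactors : C → Multiset (SimpleClass C) → Prop
  | zero {X : C} (hX : IsZero X) : HasFactors X 0
  | cons {X Y L : C} {s : Multiset (SimpleClass C)} (f : X ⟶ Y) (g : Y ⟶ L) (w : f ≫ g = 0)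
      (hS : (ShortComplex.mk f g w).ShortExact) (hL : Simple L) (hX : HasFactors X s) :
      HasFactors Y (IsoClass.mk L hL ::ₘ s)

open Classical in
/-- The composition factors of an object of finite length (independent of the chosen composition
series, by the Jordan–Hölder theorem); `0` for objects that are not of finite length. -/
def factors (X : C) : Multiset (SimpleClass C) :=
  if h : ∃ s, HasFactors X s then h.choose else 0

open Classical in
/-- The multiplicity `[X : L]` with which the simple object `L` occurs in `X`. -/
def mult (X : C) (L : SimpleClass C) : ℕ := (factors X).count L

/-- A projective cover of `X`: an essential epimorphism from a projective object onto `X`. -/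
structure ProjectiveCover (X : C) where
  /-- the covering object -/
  P : C
  projective : Projective P
  /-- the covering morphism -/
  π : P ⟶ X
  epi : Epi π
  essential : ∀ {Y : C} (g : Y ⟶ P), Epi (g ≫ π) → Epi g

variable (C)

/-- Finiteness conditions on an abelian category: every object has finite length, there are
finitely many simple objects up to isomorphism, and each of them has a projective cover. -/
class IsFiniteAbelian : Prop where
  finite_length : ∀ X : C, ∃ s, HasFactors X s
  finite_simple : Finite (SimpleClass C)
  exists_cover : ∀ X : C, Simple X → Nonempty (ProjectiveCover X)

attribute [instance] IsFiniteAbelian.finite_simple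

variable {C}

/-- The projective cover `P_i` of the simple object `L_i`. -/
def proj [IsFiniteAbelian C] (i : SimpleClass C) : C :=
  (IsFiniteAbelian.exists_cover i.obj i.obj_prop).some.P

variable (C) in
/-- The space `K(C) ⊗ ℂ` of virtual projective objects, where `K(C)` is the free abelian group on
the isomorphism classes of indecomposable projective objects. -/
abbrev VirtualProj : Type u := IndecProjClass C →₀ ℂ

/-- `IsDecomposition X n f`: the object `X` is isomorphic to the direct sum of the `n`
indecomposable projective objects `f 0, …, f (n - 1)`. -/
def IsDecomposition (X : C) (n : ℕ) (f : Fin n → IndecProjClass C) : Prop :=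
  Nonempty (X ≅ ⨁ fun a : Fin n => (f a).obj)

open Classical in
/-- The class in `K(C) ⊗ ℂ` of a projective object: the sum of the classes of its indecomposable
direct summands (well defined by the Krull–Schmidt theorem); `0` for an object that is not a finite
direct sum of indecomposable projective objects. -/
def projClass (X : C) : VirtualProj C :=
  if h : ∃ l : (n : ℕ) × (Fin n → IndecProjClass C), IsDecomposition X l.1 l.2 then
    ∑ a, Finsupp.single (h.choose.2 a) 1
  else 0

end Abelian

section Dimensions

variable {C : Type u} [Category.{v} C] [Abelian C] [MonoidalCategory C]

/-- The class `∑_L [X : L] L` of `X` in `Gr(C) ⊗ ℝ`, where the Grothendieck group `Gr(C)` is free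
on the isomorphism classes of simple objects. -/
def grClass (X : C) : SimpleClass C →₀ ℝ :=
  ((factors X).map fun L => Finsupp.single L (1 : ℝ)).sum

/-- Left multiplication by `X` on `Gr(C) ⊗ ℝ`: it sends `L_i` to the class of `X ⊗ L_i`. -/
def leftMul (X : C) : Module.End ℝ (SimpleClass C →₀ ℝ) :=
  Finsupp.linearCombination ℝ fun i : SimpleClass C => grClass (X ⊗ i.obj)

/-- The Frobenius–Perron dimension `d₊(X)`: the largest real eigenvalue of the matrix of left
multiplication by `X` on the Grothendieck ring. -/
def fpDim (X : C) : ℝ :=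
  sSup {t : ℝ | (leftMul X).HasEigenvalue t}

/-- The Frobenius–Perron dimension of a virtual projective object, by linear extension. -/
def virtualFPDim : VirtualProj C →ₗ[ℂ] ℂ :=
  Finsupp.linearCombination ℂ fun p : IndecProjClass C => ((fpDim p.obj : ℝ) : ℂ)

variable (C) [IsFiniteAbelian C]

/-- The regular virtual projective object `R_C = ∑_i d₊(L_i) P_i`. -/
def regularVirtual : VirtualProj C :=
  ∑ᶠ i : SimpleClass C, ((fpDim i.obj : ℝ) : ℂ) • projClass (proj i)

/-- The Frobenius–Perron dimension `d₊(C)` of the category: that of `R_C`. -/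
def catFPDim : ℂ := virtualFPDim (regularVirtual C)

/-- The honest object `R_C = ⨁_i P_i^{d₊(L_i)}`. The floor is there for typing only: this is meant
for a category in which the Frobenius–Perron dimensions are integers. -/
def regularObj : C :=
  ⨁ fun x : (i : SimpleClass C) × Fin ⌊fpDim i.obj⌋₊ => proj x.1

variable {C}

/-- `X` is free of rank `n`: it is isomorphic to the direct sum of `n` copies of `R_C`. -/
def IsFreeOfRank (X : C) (n : ℕ) : Prop :=
  Nonempty (X ≅ ⨁ fun _ : Fin n => regularObj C)

end Dimensions

section Functors

variable {C : Type u} [Category.{v} C] [Abelian C]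
  {D : Type u'} [Category.{v'} D] [Abelian D]

/-- Every object of `D` is a subquotient (a quotient of a subobject) of some `F(X)`. -/
def IsSurjective (F : C ⥤ D) : Prop :=
  ∀ Y : D, ∃ (X : C) (Z : D) (i : Z ⟶ F.obj X) (q : Z ⟶ Y), Mono i ∧ Epi q

/-- Quasi-tensor functors: additive, exact, faithful, and `F(X) ⊗ F(Y) ≅ F(X ⊗ Y)` for all `X`,
`Y` (no naturality or coherence is required of these isomorphisms). -/
structure IsQuasiTensor [MonoidalCategory C] [MonoidalCategory D] (F : C ⥤ D) : Prop where
  additive : F.Additive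
  left_exact : PreservesFiniteLimits F
  right_exact : PreservesFiniteColimits F
  faithful : F.Faithful
  tensor : ∀ X Y : C, Nonempty (F.obj X ⊗ F.obj Y ≅ F.obj (X ⊗ Y))

/-- The linear map on virtual projective objects induced by a functor that sends projective
objects to projective objects. -/
def mapVirtual (F : C ⥤ D) : VirtualProj C →ₗ[ℂ] VirtualProj D :=
  Finsupp.linearCombination ℂ fun p : IndecProjClass C => projClass (F.obj p.obj)

end Functors

end FiniteTensor

end

/-! Morphism spaces count everything: `homDim k (proj i) X` is the multiplicity of L_i in X, and for
projective P, `homDim k P i.obj` is the multiplicity of P_i in P. Hence a function additive on exact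
sequences is determined by its values on simples, a split additive one on projectives by its values
on the P_i, and projectives are classified by their simple quotients.

Right multiplication by the sum of the simples is strictly positive and commutes with every left
multiplication, so by Perron–Frobenius the left multiplications share a positive eigenvector. Thus
d₊ is the unique positive character of the Grothendieck ring, and F preserves it
(`IsQuasiTensor.fpDim_map`). Duality gives X ⊗ R_C = d₊(X) R_C (`sum_fpDim_mul_tensor_proj`).

Projectivity of F(P): let the defect of an object be the dimension of what remains after its
projective summands are split off. It is submultiplicative, because projectives form a tensor ideal.
Put S = ∑ d₊(L_j) defect(F(P_j)). Tensoring R_C with P_i yields d₊(P_i) S ≤ defect(F(P_i)) S. If S >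
0, no F(P_i) has a projective summand; but surjectivity, together with injectivity of projectives,
makes every projective of D a retract of some F(P). So S = 0.

Proportionality: r(Y) = ∑ d₊(L_j) dim Hom(F(P_j), Y) is then additive, and both r and d₊ are
multiplied by d₊(X) when Y is replaced by ᘁF(X) ⊗ Y. Subtract from r the largest multiple of d₊
keeping it nonnegative on simples: the difference vanishes at one simple, hence at every constituent
of its tensor products with the ᘁF(X), and surjectivity makes every simple such a constituent
(`exists_regularPairing_eq`). Comparing total dimensions identifies the factor as d₊(C)/d₊(D).

In the integral case the factor is n = dim Hom(F(R_C), 𝟙), so d₊(Y) = r(Y)/n is rational; being an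
algebraic integer, it is an integer. Freeness follows by counting simple quotients. -/

noncomputable section

open scoped ZeroObject

attribute [local instance] Abelian.hasFiniteBiproducts

namespace FiniteTensor

/-! ### Isomorphism classes and dimensions of morphism spaces -/

section IsoClass

variable {C : Type u} [Category.{v} C]

theorem IsoClass.mk_obj {P : C → Prop} (c : IsoClass P) : IsoClass.mk c.obj c.obj_prop = c :=
  @Quotient.out_eq _ (isoSetoid P) c

theorem IsoClass.mk_eq_mk_iff {P : C → Prop} {X Y : C} (hX : P X) (hY : P Y) :
    IsoClass.mk X hX = IsoClass.mk Y hY ↔ Nonempty (X ≅ Y) :=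
  @Quotient.eq _ (isoSetoid P) _ _

theorem IsoClass.obj_mk {P : C → Prop} {X : C} (hX : P X) :
    Nonempty ((IsoClass.mk X hX).obj ≅ X) :=
  (IsoClass.mk_eq_mk_iff (IsoClass.obj_prop _) hX).1 (IsoClass.mk_obj _)

theorem IsoClass.eq_iff {P : C → Prop} (c d : IsoClass P) : c = d ↔ Nonempty (c.obj ≅ d.obj) := by
  conv_lhs => rw [← c.mk_obj, ← d.mk_obj]
  exact IsoClass.mk_eq_mk_iff _ _

end IsoClass

section HomDim

variable (k : Type w) [Field k] {C : Type u} [Category.{v} C] [Abelian C] [Linear k C]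

/-- The dimension of the space of morphisms from `X` to `Y`. -/
def homDim (X Y : C) : ℕ := Module.finrank k (X ⟶ Y)

theorem homDim_congr {X X' Y Y' : C} (e : X ≅ X') (f : Y ≅ Y') :
    homDim k X Y = homDim k X' Y' :=
  (Linear.homCongr k e f).finrank_eq

/-- Morphisms out of a finite biproduct are families of morphisms. -/
def biproductHomEquiv {J : Type*} [Fintype J] (f : J → C) (Y : C) :
    ((⨁ f) ⟶ Y) ≃ₗ[k] ∀ a, (f a ⟶ Y) where
  toFun g a := biproduct.ι f a ≫ g
  map_add' _ _ := by ext; simp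
  map_smul' _ _ := by ext; simp
  invFun g := biproduct.desc g
  left_inv g := by
    apply biproduct.hom_ext'
    intro a
    simp
  right_inv g := by ext; simp

/-- Morphisms out of a binary biproduct are pairs of morphisms. -/
def biprodHomEquiv (X X' Y : C) : (X ⊞ X' ⟶ Y) ≃ₗ[k] (X ⟶ Y) × (X' ⟶ Y) where
  toFun g := (biprod.inl ≫ g, biprod.inr ≫ g)
  map_add' _ _ := by simp
  map_smul' _ _ := by simp
  invFun g := biprod.desc g.1 g.2
  left_inv g := by
    apply biprod.hom_ext' <;> simp
  right_inv g := by simp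

variable [∀ X Y : C, FiniteDimensional k (X ⟶ Y)]

theorem homDim_biproduct {J : Type*} [Fintype J] (f : J → C) (Y : C) :
    homDim k (⨁ f) Y = ∑ a, homDim k (f a) Y := by
  unfold homDim
  rw [(biproductHomEquiv k f Y).finrank_eq, Module.finrank_pi_fintype]

theorem homDim_biprod (X X' Y : C) :
    homDim k (X ⊞ X') Y = homDim k X Y + homDim k X' Y := by
  unfold homDim
  rw [(biprodHomEquiv k X X' Y).finrank_eq, Module.finrank_prod]

theorem homDim_ne_zero_iff {X Y : C} : homDim k X Y ≠ 0 ↔ ∃ f : X ⟶ Y, f ≠ 0 := by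
  unfold homDim
  rw [← pos_iff_ne_zero, Module.finrank_pos_iff_exists_ne_zero]

theorem homDim_of_isZero {X Y : C} (h : IsZero X) : homDim k X Y = 0 := by
  by_contra hne
  obtain ⟨f, hf⟩ := (homDim_ne_zero_iff k).1 hne
  exact hf (h.eq_of_src _ _)

theorem homDim_shortExact (P : C) [Projective P] {S : ShortComplex C} (hS : S.ShortExact) :
    homDim k P S.X₂ = homDim k P S.X₁ + homDim k P S.X₃ := by
  have := hS.mono_f
  have := hS.epi_g
  let f := Linear.rightComp k P S.f
  let g := Linear.rightComp k P S.g
  have hf : Function.Injective f := fun a b hab => (cancel_mono S.f).1 hab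
  have hg : Function.Surjective g := fun a =>
    ⟨Projective.factorThru a S.g, Projective.factorThru_comp a S.g⟩
  have hfg : LinearMap.ker g = LinearMap.range f := by
    ext a
    constructor
    · intro ha
      exact ⟨hS.exact.lift a ha, hS.exact.lift_f a ha⟩
    · rintro ⟨b, rfl⟩
      change (b ≫ S.f) ≫ S.g = 0
      simp
  have h := g.finrank_range_add_finrank_ker
  rw [hfg, LinearMap.finrank_range_of_inj hf, LinearMap.range_eq_top.2 hg, finrank_top] at h
  unfold homDim
  omega

end HomDim

/-! ### Additive and split additive functions on objects -/

section Additive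

variable {C : Type u} [Category.{v} C] [Abelian C] {M : Type*} [AddCommGroup M]

/-- A function on objects that is additive on short exact sequences. -/
def IsAdditive (φ : C → M) : Prop :=
  ∀ ⦃S : ShortComplex C⦄, S.ShortExact → φ S.X₂ = φ S.X₁ + φ S.X₃

/-- An isomorphism invariant function on objects that is additive on direct sums. -/
structure IsSplitAdditive (φ : C → M) : Prop where
  iso : ∀ {X Y : C}, (X ≅ Y) → φ X = φ Y
  biprod : ∀ X Y : C, φ (X ⊞ Y) = φ X + φ Y

theorem IsAdditive.of_isZero {φ : C → M} (h : IsAdditive φ) {X : C} (hX : IsZero X) : φ X = 0 := by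
  have hS : (ShortComplex.mk (0 : X ⟶ X) (0 : X ⟶ X) (by simp)).ShortExact :=
    ShortComplex.ShortExact.mk' (ShortComplex.exact_of_isZero_X₂ _ hX)
      ⟨fun _ _ _ => hX.eq_of_tgt _ _⟩ ⟨fun _ _ _ => hX.eq_of_src _ _⟩
  simpa using h hS

theorem IsAdditive.isSplitAdditive {φ : C → M} (h : IsAdditive φ) : IsSplitAdditive φ where
  iso {X Y} e := by
    have hS : (ShortComplex.mk e.hom (0 : Y ⟶ 0) (by simp)).ShortExact :=
      ShortComplex.ShortExact.mk' (by
        rw [ShortComplex.exact_iff_epi _ rfl]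
        dsimp
        infer_instance)
        (by dsimp; infer_instance) ⟨fun _ _ _ => (isZero_zero C).eq_of_src _ _⟩
    have := h hS
    dsimp at this
    rw [h.of_isZero (isZero_zero C), add_zero] at this
    exact this.symm
  biprod X Y := by
    have hS : (ShortComplex.mk (biprod.inl : X ⟶ X ⊞ Y) biprod.snd (by simp)).ShortExact :=
      (ShortComplex.Splitting.ofHasBinaryBiproduct X Y).shortExact
    exact h hS

theorem isAdditive_homDim (k : Type w) [Field k] [Linear k C]
    [∀ X Y : C, FiniteDimensional k (X ⟶ Y)] (P : C) [Projective P] :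
    IsAdditive (fun X : C => (homDim k P X : ℝ)) := fun S hS => by
  dsimp
  rw [homDim_shortExact k P hS, Nat.cast_add]

theorem isSplitAdditive_homDim (k : Type w) [Field k] [Linear k C]
    [∀ X Y : C, FiniteDimensional k (X ⟶ Y)] (Y : C) :
    IsSplitAdditive (fun X : C => (homDim k X Y : ℝ)) where
  iso e := by simp [homDim_congr k e (Iso.refl _)]
  biprod X X' := by simp [homDim_biprod]

theorem IsSplitAdditive.of_isZero {φ : C → M} (h : IsSplitAdditive φ) {X : C} (hX : IsZero X) :
    φ X = 0 := by
  have e : X ≅ X ⊞ X :=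
    hX.iso ((IsZero.iff_id_eq_zero _).2 (by apply biprod.hom_ext <;> exact hX.eq_of_tgt _ _))
  have := h.iso e
  rw [h.biprod] at this
  simpa using this

theorem exists_biprod_iso_of_epi {X P : C} [Projective P] (g : X ⟶ P) [Epi g] :
    Nonempty (X ≅ kernel g ⊞ P) := by
  have hS : (ShortComplex.mk (kernel.ι g) g (by simp)).ShortExact :=
    ShortComplex.ShortExact.mk' (ShortComplex.exact_of_f_is_kernel _ (kernelIsKernel g))
      inferInstance inferInstance
  exact ⟨(hS.splittingOfProjective).isoBinaryBiproduct⟩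

theorem projective_biproduct {J : Type*} [Finite J] (f : J → C) (hf : ∀ a, Projective (f a)) :
    Projective (⨁ f) where
  factors g e _ := ⟨biproduct.desc fun a => Projective.factorThru (biproduct.ι f a ≫ g) e, by
    apply biproduct.hom_ext'
    intro a
    simp⟩

theorem projective_of_biprod_left {X Y : C} (h : Projective (X ⊞ Y)) : Projective X :=
  Retract.projective (Y := X ⊞ Y) ⟨biprod.inl, biprod.fst, by simp⟩

end Additive

/-! ### Projective covers and multiplicities of simples -/

section Finite

variable {C : Type u} [Category.{v} C] [Abelian C]

instance simple_obj (i : SimpleClass C) : Simple i.obj := i.obj_prop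

variable [IsFiniteAbelian C]

/-- The projection of the projective cover onto the simple object. -/
def projπ (i : SimpleClass C) : proj i ⟶ i.obj :=
  (IsFiniteAbelian.exists_cover i.obj i.obj_prop).some.π

instance projective_proj (i : SimpleClass C) : Projective (proj i) :=
  (IsFiniteAbelian.exists_cover i.obj i.obj_prop).some.projective

instance epi_projπ (i : SimpleClass C) : Epi (projπ i) :=
  (IsFiniteAbelian.exists_cover i.obj i.obj_prop).some.epi

theorem epi_of_comp_projπ_ne_zero {i : SimpleClass C} {X : C} (g : X ⟶ proj i)
    (h : g ≫ projπ i ≠ 0) : Epi g :=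
  (IsFiniteAbelian.exists_cover i.obj i.obj_prop).some.essential g (epi_of_nonzero_to_simple h)

theorem projπ_ne_zero (i : SimpleClass C) : projπ i ≠ 0 := fun h => by
  have : Epi (0 : proj i ⟶ i.obj) := h ▸ epi_projπ i
  exact id_nonzero i.obj ((IsZero.iff_id_eq_zero _).1 (IsZero.of_epi_zero (proj i) i.obj))

theorem exists_hom_simple_ne_zero {X : C} (hX : ¬ IsZero X) :
    ∃ (i : SimpleClass C) (f : X ⟶ i.obj), f ≠ 0 := by
  obtain ⟨s, hs⟩ := IsFiniteAbelian.finite_length X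
  cases hs with
  | zero h => exact absurd h hX
  | @cons A Y L s f g w hS hL hA =>
    obtain ⟨e⟩ := IsoClass.obj_mk hL
    have : Epi g := hS.epi_g
    refine ⟨IsoClass.mk L hL, g ≫ e.inv, fun h => ?_⟩
    have h0 : g = 0 := by simpa using congr($h ≫ e.hom)
    subst h0
    exact Simple.not_isZero L (IsZero.of_epi_zero X L)

/-- Every morphism from a projective cover to a simple object factors through the projection. -/
theorem exists_projπ_comp_eq {i j : SimpleClass C} (f : proj i ⟶ j.obj) :
    ∃ g : i.obj ⟶ j.obj, projπ i ≫ g = f := by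
  by_cases hf : f = 0
  · exact ⟨0, by simp [hf]⟩
  -- Otherwise the kernel of f would map onto P_i, because the cover is essential, and f would
  -- vanish.
  have hk : kernel.ι f ≫ projπ i = 0 := by
    by_contra h
    have := epi_of_comp_projπ_ne_zero _ h
    exact hf ((cancel_epi (kernel.ι f)).1 (by simp))
  have : Epi f := epi_of_nonzero_to_simple hf
  obtain ⟨g, hg⟩ : ∃ g : j.obj ⟶ i.obj, f ≫ g = projπ i := by
    have hS : (ShortComplex.mk (kernel.ι f) f (by simp)).Exact :=
      ShortComplex.exact_of_f_is_kernel _ (kernelIsKernel f)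
    exact ⟨hS.desc _ hk, hS.g_desc _ hk⟩
  have hg0 : g ≠ 0 := fun h => projπ_ne_zero i (by rw [← hg, h, comp_zero])
  have := isIso_of_hom_simple hg0
  exact ⟨inv g, by simp [← hg]⟩

end Finite

section Multiplicities

variable (k : Type w) [Field k] [IsAlgClosed k] {C : Type u} [Category.{v} C] [Abelian C]
  [Linear k C] [∀ X Y : C, FiniteDimensional k (X ⟶ Y)] [IsFiniteAbelian C]

open Classical in
theorem homDim_proj_simple (i j : SimpleClass C) :
    homDim k (proj i) j.obj = if i = j then 1 else 0 := by
  have h : homDim k (proj i) j.obj = homDim k i.obj j.obj := by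
    refine (LinearEquiv.finrank_eq (LinearEquiv.ofBijective
      (Linear.leftComp k j.obj (projπ i)) ⟨fun a b hab => ?_, fun f => ?_⟩)).symm
    · exact (cancel_epi (projπ i)).1 hab
    · exact exists_projπ_comp_eq f
  rw [h, homDim, finrank_hom_simple_simple, IsoClass.eq_iff]

open Classical in
-- Since Hom(P_i, -) is exact and detects exactly L_i among the simples, no appeal to Jordan–Hölder
-- is needed to see that the factors do not depend on the series.
theorem HasFactors.count_eq {X : C} {s : Multiset (SimpleClass C)} (h : HasFactors X s)
    (i : SimpleClass C) : s.count i = homDim k (proj i) X := by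
  induction h with
  | zero hX =>
    symm
    by_contra hne
    obtain ⟨f, hf⟩ := (homDim_ne_zero_iff k).1 hne
    exact hf (hX.eq_of_tgt _ _)
  | @cons X Y L s f g w hS hL hX ih =>
    rw [homDim_shortExact k (proj i) hS, ← ih, Multiset.count_cons]
    obtain ⟨e⟩ := IsoClass.obj_mk hL
    rw [← homDim_congr k (Iso.refl (proj i)) e, homDim_proj_simple]

theorem hasFactors_factors (X : C) : HasFactors X (factors X) := by
  have h := IsFiniteAbelian.finite_length X
  rw [factors, dif_pos h]
  exact h.choose_spec

variable [Fintype (SimpleClass C)]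

theorem IsAdditive.eq_sum {M : Type*} [AddCommGroup M] {φ : C → M} (h : IsAdditive φ) (X : C) :
    φ X = ∑ i : SimpleClass C, homDim k (proj i) X • φ i.obj := by
  classical
  have key : ∀ {Y : C} {s : Multiset (SimpleClass C)}, HasFactors Y s →
      φ Y = ∑ i : SimpleClass C, homDim k (proj i) Y • φ i.obj := by
    intro Y s hs
    induction hs with
    | zero hX =>
      rw [h.of_isZero hX]
      refine (Finset.sum_eq_zero fun i _ => ?_).symm
      rw [← (HasFactors.zero hX).count_eq k i]
      simp
    | @cons X Y L s f g w hS hL hX ih =>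
      have h1 := h hS
      dsimp at h1
      obtain ⟨e⟩ := IsoClass.obj_mk hL
      rw [h1, ih, ← h.isSplitAdditive.iso e]
      simp_rw [homDim_shortExact k _ hS, add_smul, Finset.sum_add_distrib,
        ← homDim_congr k (Iso.refl _) e, homDim_proj_simple]
      simp
  exact key (hasFactors_factors X)

end Multiplicities

/-! ### Classification of projective objects -/

section Projectives

variable {C : Type u} [Category.{v} C] [Abelian C] [IsFiniteAbelian C]

theorem exists_biprod_proj_iso {X : C} {i : SimpleClass C} (g : X ⟶ proj i)
    (h : g ≫ projπ i ≠ 0) : ∃ Y : C, Nonempty (X ≅ Y ⊞ proj i) :=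
  have := epi_of_comp_projπ_ne_zero g h
  ⟨kernel g, exists_biprod_iso_of_epi g⟩

theorem exists_biprod_proj_iso_of_hom {P : C} [Projective P] {i : SimpleClass C} (f : P ⟶ i.obj)
    (hf : f ≠ 0) : ∃ Y : C, Projective Y ∧ Nonempty (P ≅ Y ⊞ proj i) := by
  obtain ⟨Y, ⟨e⟩⟩ := exists_biprod_proj_iso (Projective.factorThru f (projπ i))
    (by rwa [Projective.factorThru_comp])
  exact ⟨Y, projective_of_biprod_left (Projective.of_iso e inferInstance), ⟨e⟩⟩

variable (k : Type w) [Field k] [Linear k C]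
  [∀ X Y : C, FiniteDimensional k (X ⟶ Y)]

theorem isZero_of_homDim_simple {X : C} (h : ∀ i : SimpleClass C, homDim k X i.obj = 0) :
    IsZero X := by
  by_contra hX
  obtain ⟨i, f, hf⟩ := exists_hom_simple_ne_zero hX
  exact (homDim_ne_zero_iff k).2 ⟨f, hf⟩ (h i)

variable [IsAlgClosed k]

include k in
/-- Induction on projective objects: add one projective cover of a simple object at a time. -/
theorem projective_induction {motive : C → Prop}
    (iso : ∀ X Y : C, (X ≅ Y) → motive X → motive Y) (zero : ∀ X : C, IsZero X → motive X)
    (biprod : ∀ (X : C) (i : SimpleClass C), Projective X → motive X → motive (X ⊞ proj i))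
    (P : C) (hP : Projective P) : motive P := by
  classical
  have := Fintype.ofFinite (SimpleClass C)
  -- Induct on the length of the largest semisimple quotient; splitting off one P_i lowers it by
  -- one.
  obtain ⟨n, hn⟩ : ∃ n, n = ∑ i : SimpleClass C, homDim k P i.obj := ⟨_, rfl⟩
  induction n generalizing P with
  | zero =>
    refine zero P (isZero_of_homDim_simple k fun i => ?_)
    exact (Finset.sum_eq_zero_iff.1 hn.symm) i (Finset.mem_univ i)
  | succ n ih =>
    obtain ⟨i, -, hi⟩ := Finset.exists_ne_zero_of_sum_ne_zero (hn.symm.trans_ne n.succ_ne_zero)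
    obtain ⟨f, hf⟩ := (homDim_ne_zero_iff k).1 hi
    obtain ⟨Y, hY, ⟨e⟩⟩ := exists_biprod_proj_iso_of_hom f hf
    refine iso _ _ e.symm (biprod Y i hY (ih Y hY ?_))
    simp_rw [homDim_congr k e (Iso.refl _), homDim_biprod, Finset.sum_add_distrib,
      homDim_proj_simple] at hn
    simpa using hn

theorem IsSplitAdditive.eq_sum [Fintype (SimpleClass C)] {M : Type*} [AddCommGroup M] {φ : C → M}
    (h : IsSplitAdditive φ) (P : C) [hP : Projective P] :
    φ P = ∑ i : SimpleClass C, homDim k P i.obj • φ (proj i) := by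
  classical
  refine projective_induction k (motive := fun P => φ P = ∑ i, homDim k P i.obj • φ (proj i))
    (fun X Y e hX => ?_) (fun X hX => ?_) (fun X i _ hX => ?_) P hP
  · simp_rw [← h.iso e, hX, homDim_congr k e (Iso.refl _)]
  · simp [h.of_isZero hX, homDim_of_isZero k hX]
  · rw [h.biprod, hX]
    simp [homDim_biprod, homDim_proj_simple, add_smul, Finset.sum_add_distrib]

/-- Projective objects with the same simple quotients, counted with multiplicity, are
isomorphic. -/
theorem nonempty_iso_of_homDim_eq (P Q : C) [hP : Projective P] [hQ : Projective Q]
    (h : ∀ i : SimpleClass C, homDim k P i.obj = homDim k Q i.obj) : Nonempty (P ≅ Q) := by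
  classical
  refine projective_induction k
    (motive := fun P => ∀ Q : C, Projective Q →
      (∀ i : SimpleClass C, homDim k P i.obj = homDim k Q i.obj) → Nonempty (P ≅ Q))
    (fun X Y e hX Q hQ hY => ?_) (fun X hX Q hQ h => ?_) (fun X i hXp hX Q hQ h => ?_) P hP Q hQ h
  · obtain ⟨f⟩ := hX Q hQ fun i => by rw [homDim_congr k e (Iso.refl _), hY]
    exact ⟨e.symm.trans f⟩
  · refine ⟨hX.iso (isZero_of_homDim_simple k fun i => ?_)⟩
    rw [← h i, homDim_of_isZero k hX]
  · have hi : homDim k Q i.obj ≠ 0 := by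
      rw [← h i, homDim_biprod, homDim_proj_simple]
      simp
    obtain ⟨f, hf⟩ := (homDim_ne_zero_iff k).1 hi
    obtain ⟨Y, hY, ⟨e⟩⟩ := exists_biprod_proj_iso_of_hom f hf
    obtain ⟨e'⟩ := hX Y hY fun j => by
      have := h j
      rw [homDim_congr k e (Iso.refl _), homDim_biprod, homDim_biprod] at this
      omega
    exact ⟨(biprod.mapIso e' (Iso.refl _)).trans e.symm⟩

include k in
-- P_i has a single simple quotient, with multiplicity one, so one of two complementary summands has
-- none and is zero.
theorem indecomposable_proj (i : SimpleClass C) : Indecomposable (proj i) := by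
  classical
  refine ⟨fun h => projπ_ne_zero i (h.eq_of_src _ _), fun Y Z e => ?_⟩
  have hj : ∀ j : SimpleClass C, homDim k Y j.obj + homDim k Z j.obj = if i = j then 1 else 0 :=
    fun j => by rw [← homDim_biprod, ← homDim_congr k e (Iso.refl _), homDim_proj_simple]
  by_cases h : homDim k Y i.obj = 0
  · refine Or.inl (isZero_of_homDim_simple k fun j => ?_)
    by_cases hij : i = j
    · exact hij ▸ h
    · have := hj j
      rw [if_neg hij] at this
      omega
  · refine Or.inr (isZero_of_homDim_simple k fun j => ?_)
    have := hj j
    split_ifs at this with hij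
    · subst hij
      omega
    · omega

/-- The class of the projective cover of a simple object. -/
def projIndec (i : SimpleClass C) : IndecProjClass C :=
  IsoClass.mk (proj i) ⟨indecomposable_proj k i, projective_proj i⟩

theorem projIndec_bijective : Function.Bijective (projIndec (C := C) k) := by
  classical
  refine ⟨fun i j h => ?_, fun p => ?_⟩
  · obtain ⟨e⟩ := (IsoClass.mk_eq_mk_iff _ _).1 h
    have := homDim_congr k e (Iso.refl i.obj)
    rw [homDim_proj_simple, homDim_proj_simple, if_pos rfl] at this
    by_contra hij
    rw [if_neg (Ne.symm hij)] at this
    omega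
  · obtain ⟨hp, _⟩ := p.obj_prop
    obtain ⟨i, f, hf⟩ := exists_hom_simple_ne_zero hp.1
    obtain ⟨Y, hY, ⟨e⟩⟩ := exists_biprod_proj_iso_of_hom f hf
    have hY0 : IsZero Y := (hp.2 _ _ e).resolve_right (indecomposable_proj k i).1
    refine ⟨i, ?_⟩
    rw [← p.mk_obj]
    refine (IsoClass.mk_eq_mk_iff _ _).2 ⟨Iso.symm (e.trans ?_)⟩
    exact ⟨biprod.snd, biprod.inr, by
      apply biprod.hom_ext'
      · exact hY0.eq_of_src _ _
      · simp, by simp⟩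

theorem nonempty_projIndec_obj_iso (i : SimpleClass C) :
    Nonempty ((projIndec k i).obj ≅ proj i) :=
  IsoClass.obj_mk _

open Classical in
theorem homDim_obj_projIndec (i j : SimpleClass C) :
    homDim k (projIndec k i).obj j.obj = if i = j then 1 else 0 := by
  obtain ⟨g⟩ := nonempty_projIndec_obj_iso k i
  rw [homDim_congr k g (Iso.refl _), homDim_proj_simple]

include k in
theorem exists_isDecomposition (P : C) [Projective P] :
    ∃ l : (n : ℕ) × (Fin n → IndecProjClass C), IsDecomposition P l.1 l.2 := by
  classical
  have := Fintype.ofFinite (SimpleClass C)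
  let J := (i : SimpleClass C) × Fin (homDim k P i.obj)
  let e : J ≃ Fin (Fintype.card J) := Fintype.equivFin J
  let f : Fin (Fintype.card J) → IndecProjClass C := fun a => projIndec k (e.symm a).1
  have hf : ∀ a, Projective (f a).obj := fun a => (f a).obj_prop.2
  have := projective_biproduct _ hf
  refine ⟨⟨_, f⟩, nonempty_iso_of_homDim_eq k P (⨁ fun a => (f a).obj) fun j => ?_⟩
  have h1 : ∀ a, homDim k (f a).obj j.obj = if (e.symm a).1 = j then 1 else 0 := fun a =>
    homDim_obj_projIndec k _ j
  rw [homDim_biproduct]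
  simp_rw [h1]
  rw [Equiv.sum_comp e.symm (fun x : J => if x.1 = j then 1 else 0), Fintype.sum_sigma]
  simp [apply_ite Finset.card]

/-- Plays the role of Krull–Schmidt: the number of summands P_i in any decomposition is read off
from Hom(P, L_i). -/
theorem projClass_eq [Fintype (SimpleClass C)] (P : C) [Projective P] :
    projClass P = ∑ i : SimpleClass C, Finsupp.single (projIndec k i) (homDim k P i.obj : ℂ) := by
  classical
  have h := exists_isDecomposition k P
  rw [projClass, dif_pos h]
  obtain ⟨e⟩ := h.choose_spec
  generalize h.choose = l at e
  obtain ⟨n, f⟩ := l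
  obtain ⟨s, hs⟩ := (projIndec_bijective (C := C) k).2.hasRightInverse
  have h1 : ∀ i : SimpleClass C, homDim k P i.obj = ∑ a : Fin n, if s (f a) = i then 1 else 0 := by
    intro i
    rw [homDim_congr k e (Iso.refl _), homDim_biproduct]
    refine Finset.sum_congr rfl fun a _ => ?_
    rw [← homDim_obj_projIndec k, hs]
  simp_rw [h1]
  push_cast
  simp_rw [Finsupp.single_finsetSum]
  rw [Finset.sum_comm]
  refine Finset.sum_congr rfl fun a _ => ?_
  rw [Finset.sum_eq_single (s (f a))]
  · simp [hs (f a)]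
  · intro i _ hi
    simp [Ne.symm hi]
  · simp

end Projectives

/-! ### Perron–Frobenius theory -/

section PerronFrobenius

variable {I : Type*} [Fintype I] [Nonempty I]

/-- Collatz–Wielandt: maximise r subject to r x ≤ T x over the simplex. A maximiser that is not an
eigenvector could be improved by applying T once more. -/
theorem exists_eigenvector_of_positive (T : (I → ℝ) →ₗ[ℝ] (I → ℝ))
    (hT : ∀ w : I → ℝ, 0 ≤ w → w ≠ 0 → ∀ i, 0 < T w i) :
    ∃ (v : I → ℝ) (r : ℝ), (∀ i, 0 < v i) ∧ T v = r • v := by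
  classical
  have hTc : Continuous T := T.continuous_of_finiteDimensional
  have hne : ∀ x ∈ stdSimplex ℝ I, x ≠ 0 := by
    rintro x hx rfl
    simpa using hx.2
  have hcs : Continuous fun x : I → ℝ => ∑ i, T x i :=
    continuous_finsetSum _ fun i _ => (continuous_apply i).comp hTc
  obtain ⟨B, hB⟩ := (isCompact_stdSimplex ℝ I).bddAbove_image hcs.continuousOn
  have hbound : ∀ x ∈ stdSimplex ℝ I, ∀ t : ℝ, t • x ≤ T x → t ≤ B := by
    intro x hx t ht
    calc t = ∑ i, t * x i := by rw [← Finset.mul_sum, hx.2, mul_one]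
      _ ≤ ∑ i, T x i := Finset.sum_le_sum fun i _ => ht i
      _ ≤ B := hB ⟨x, hx, rfl⟩
  let S : Set ((I → ℝ) × ℝ) :=
    (stdSimplex ℝ I ×ˢ Set.Icc 0 B) ∩ {p | p.2 • p.1 ≤ T p.1}
  have hS : IsCompact S := by
    refine ((isCompact_stdSimplex ℝ I).prod isCompact_Icc).inter_right ?_
    exact isClosed_le (continuous_snd.smul continuous_fst) (hTc.comp continuous_fst)
  obtain ⟨i0⟩ := ‹Nonempty I›
  have hx0 := single_mem_stdSimplex ℝ i0
  have hT0 : ∀ x ∈ stdSimplex ℝ I, (0 : ℝ) • x ≤ T x := fun x hx i => by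
    simpa using (hT x hx.1 (hne x hx) i).le
  have hSne : S.Nonempty :=
    ⟨(Pi.single i0 1, 0), ⟨hx0, le_rfl, hbound _ hx0 0 (hT0 _ hx0)⟩, hT0 _ hx0⟩
  obtain ⟨⟨v, r⟩, ⟨⟨hv, hr0, hrB⟩, hvr⟩, hmax⟩ := hS.exists_isMaxOn hSne continuous_snd.continuousOn
  dsimp only [Set.mem_ofPred_eq] at hvr hv hr0 hrB
  have hTv := hT v hv.1 (hne v hv)
  have hev : T v = r • v := by
    by_contra hcon
    have hw := hT (T v - r • v) (sub_nonneg.2 hvr) (sub_ne_zero.2 hcon)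
    have hspos : 0 < ∑ i, T v i := Finset.sum_pos (fun i _ => hTv i) ⟨i0, Finset.mem_univ _⟩
    set s := ∑ i, T v i with hs
    -- The normalised image of v satisfies r y < T y in every coordinate, so r can be raised by the
    -- smallest gap ε; the coordinates of y are at most 1.
    let y : I → ℝ := s⁻¹ • T v
    have hy : y ∈ stdSimplex ℝ I := by
      refine ⟨fun i => mul_nonneg (inv_nonneg.2 hspos.le) (hTv i).le, ?_⟩
      change ∑ i, s⁻¹ * T v i = 1
      rw [← Finset.mul_sum, inv_mul_cancel₀ hspos.ne']
    have hy1 : ∀ i, 0 < T y i - r * y i := by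
      intro i
      have h1 : T y i - r * y i = s⁻¹ * (T (T v - r • v) i) := by
        simp [y]
        ring
      rw [h1]
      exact mul_pos (inv_pos.2 hspos) (hw i)
    obtain ⟨j, -, hj⟩ := Finset.exists_min_image Finset.univ (fun i => T y i - r * y i)
      ⟨i0, Finset.mem_univ _⟩
    set ε := T y j - r * y j with hε
    have hle : (r + ε) • y ≤ T y := by
      intro i
      have h2 := hj i (Finset.mem_univ i)
      have h3 : y i ≤ 1 := by
        rw [← hy.2]
        exact Finset.single_le_sum (fun i _ => hy.1 i) (Finset.mem_univ i)
      have h4 : ε * y i ≤ ε := mul_le_of_le_one_right (hy1 j).le h3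
      change (r + ε) * y i ≤ T y i
      nlinarith
    have hmem : (y, r + ε) ∈ S :=
      ⟨⟨hy, add_nonneg hr0 (hy1 j).le, hbound y hy _ hle⟩, hle⟩
    have := hmax hmem
    have hpos := hy1 j
    simp only [Set.mem_ofPred_eq] at this
    linarith
  refine ⟨v, r, fun i => ?_, hev⟩
  have h5 := hTv i
  rw [hev] at h5
  exact pos_of_mul_pos_right h5 hr0

/-- Subtract from w the largest multiple of v below it. The difference is nonnegative and zero at
some j; if it were nonzero, T would make it positive at j, although T only rescales it. -/
theorem eigenvector_unique_of_positive (T : (I → ℝ) →ₗ[ℝ] (I → ℝ))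
    (hT : ∀ w : I → ℝ, 0 ≤ w → w ≠ 0 → ∀ i, 0 < T w i) {v w : I → ℝ} {r : ℝ}
    (hv : ∀ i, 0 < v i) (hTv : T v = r • v) (hTw : T w = r • w) : ∃ c : ℝ, w = c • v := by
  obtain ⟨j, -, hj⟩ := Finset.exists_min_image Finset.univ (fun i => w i / v i)
    Finset.univ_nonempty
  refine ⟨w j / v j, ?_⟩
  by_contra hne
  have h := hT (w - (w j / v j) • v) (fun i => ?_) (sub_ne_zero.2 hne) j
  · rw [map_sub, map_smul, hTv, hTw] at h
    have hvj := (hv j).ne'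
    simp only [Pi.sub_apply, Pi.smul_apply, smul_eq_mul] at h
    field_simp at h
    simp at h
  · have := (le_div_iff₀ (hv i)).1 (hj i (Finset.mem_univ i))
    simpa using this

/-- Scale v until it dominates an eigenvector w and touches it at a coordinate j with w j > 0;
applying M there gives (d - t) w j ≥ 0. -/
theorem isGreatest_eigenvalue_of_nonneg (M : Module.End ℝ (I →₀ ℝ))
    (hM : ∀ w : I →₀ ℝ, (∀ i, 0 ≤ w i) → ∀ i, 0 ≤ M w i) {v : I →₀ ℝ} {d : ℝ}
    (hv : ∀ i, 0 < v i) (hMv : M v = d • v) : IsGreatest {t : ℝ | M.HasEigenvalue t} d := by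
  refine ⟨Module.End.hasEigenvalue_of_hasEigenvector (x := v)
    ⟨Module.End.mem_eigenspace_iff.2 hMv, fun h => ?_⟩, fun t ht => ?_⟩
  · have := hv (Classical.arbitrary I)
    rw [h] at this
    simp at this
  obtain ⟨w, hw⟩ := ht.exists_hasEigenvector
  have key : ∀ w : I →₀ ℝ, M w = t • w → (∃ i, 0 < w i) → t ≤ d := by
    rintro w hw ⟨i, hi⟩
    obtain ⟨j, -, hj⟩ := Finset.exists_max_image Finset.univ (fun i => w i / v i)
      Finset.univ_nonempty
    have hjpos : 0 < w j := by
      have := (div_pos hi (hv i)).trans_le (hj i (Finset.mem_univ i))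
      rwa [div_pos_iff_of_pos_right (hv j)] at this
    have h := hM ((w j / v j) • v - w) (fun i => by
      have := (div_le_iff₀ (hv i)).1 (hj i (Finset.mem_univ i))
      simpa using this) j
    rw [map_sub, map_smul, hMv, hw] at h
    have hvj := (hv j).ne'
    simp only [Finsupp.sub_apply, Finsupp.smul_apply, smul_eq_mul] at h
    have h1 : w j / v j * (d * v j) - t * w j = (d - t) * w j := by
      field_simp
    rw [h1] at h
    exact sub_nonneg.1 (nonneg_of_mul_nonneg_left h hjpos)
  obtain ⟨i, hi⟩ := Finsupp.ne_iff.1 hw.2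
  rcases lt_or_gt_of_ne hi with h | h
  · exact key (-w) (by rw [map_neg, hw.apply_eq_smul, smul_neg]) ⟨i, by simpa using h⟩
  · exact key w hw.apply_eq_smul ⟨i, h⟩

/-- Operators that commute with a strictly positive operator have a common positive
eigenvector. -/
theorem exists_common_eigenvector (N : Module.End ℝ (I →₀ ℝ))
    (hN : ∀ w : I →₀ ℝ, (∀ i, 0 ≤ w i) → w ≠ 0 → ∀ i, 0 < N w i) :
    ∃ v : I →₀ ℝ, (∀ i, 0 < v i) ∧
      ∀ M : Module.End ℝ (I →₀ ℝ), (∀ w, M (N w) = N (M w)) → ∃ d : ℝ, M v = d • v := by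
  let e := Finsupp.linearEquivFunOnFinite ℝ ℝ I
  let T : (I → ℝ) →ₗ[ℝ] (I → ℝ) := e.toLinearMap ∘ₗ N ∘ₗ e.symm.toLinearMap
  have hT : ∀ w : I → ℝ, 0 ≤ w → w ≠ 0 → ∀ i, 0 < T w i := by
    intro w hw hne i
    refine hN (e.symm w) hw ?_ i
    simpa using hne
  have hTe : ∀ (w : I →₀ ℝ) (r : ℝ), T (e w) = r • e w ↔ N w = r • w := by
    intro w r
    simp only [T, LinearMap.comp_apply, LinearEquiv.coe_coe, e.symm_apply_apply]
    rw [← map_smul, e.injective.eq_iff]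
  obtain ⟨v, r, hv, hTv⟩ := exists_eigenvector_of_positive T hT
  have hNv : N (e.symm v) = r • e.symm v := (hTe _ _).1 (by simpa using hTv)
  refine ⟨e.symm v, hv, fun M hM => ?_⟩
  -- M preserves the r-eigenspace of N, which is a line.
  have h1 : N (M (e.symm v)) = r • M (e.symm v) := by rw [← hM, hNv, map_smul]
  obtain ⟨c, hc⟩ := eigenvector_unique_of_positive T hT hv hTv ((hTe _ _).2 h1)
  refine ⟨c, e.injective ?_⟩
  rw [hc, map_smul, e.apply_symm_apply]

end PerronFrobenius

/-! ### Exactness, duality and projectives in rigid categories -/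

section CompFunctor

variable {C : Type u} [Category.{v} C] [Abelian C] {D : Type u'} [Category.{v'} D] [Abelian D]
  {M : Type*} [AddCommGroup M]

theorem IsAdditive.comp_functor {φ : D → M} (h : IsAdditive φ) (F : C ⥤ D)
    [PreservesFiniteLimits F] [PreservesFiniteColimits F] [F.Additive] :
    IsAdditive fun X => φ (F.obj X) := fun _ hS => h (hS.map_of_exact F)

theorem IsSplitAdditive.comp_functor {φ : D → M} (h : IsSplitAdditive φ) (F : C ⥤ D)
    [F.Additive] : IsSplitAdditive fun X => φ (F.obj X) where
  iso e := h.iso (F.mapIso e)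
  biprod X Y := by
    have := preservesBinaryBiproducts_of_preservesBiproducts F
    rw [← h.biprod]
    exact h.iso (F.mapBiprod X Y)

end CompFunctor

section Preadditive

variable {C : Type u} [Category.{v} C] [Preadditive C] [MonoidalCategory C]
  [MonoidalPreadditive C]

theorem isZero_tensor_left (X : C) {Y : C} (hY : IsZero Y) : IsZero (X ⊗ Y) :=
  (tensorLeft X).map_isZero hY

end Preadditive

section Rigid

variable {C : Type u} [Category.{v} C] [Abelian C] [MonoidalCategory C] [RigidCategory C]

instance preservesFiniteColimits_tensorLeft (X : C) : PreservesFiniteColimits (tensorLeft X) :=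
  have := (tensorLeftAdjunction (ᘁX) X).leftAdjoint_preservesColimits
  inferInstance

instance preservesFiniteLimits_tensorLeft (X : C) : PreservesFiniteLimits (tensorLeft X) :=
  have := (tensorLeftAdjunction X (Xᘁ)).rightAdjoint_preservesLimits
  inferInstance

instance preservesFiniteColimits_tensorRight (X : C) : PreservesFiniteColimits (tensorRight X) :=
  have := (tensorRightAdjunction X (Xᘁ)).leftAdjoint_preservesColimits
  inferInstance

instance preservesFiniteLimits_tensorRight (X : C) : PreservesFiniteLimits (tensorRight X) :=
  have := (tensorRightAdjunction (ᘁX) X).rightAdjoint_preservesLimits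
  inferInstance

instance epi_whiskerLeft (X : C) {Y Z : C} (f : Y ⟶ Z) [Epi f] : Epi (X ◁ f) :=
  inferInstanceAs (Epi ((tensorLeft X).map f))

instance epi_whiskerRight (X : C) {Y Z : C} (f : Y ⟶ Z) [Epi f] : Epi (f ▷ X) :=
  inferInstanceAs (Epi ((tensorRight X).map f))

theorem projective_tensor_left (X P : C) [hP : Projective P] : Projective (X ⊗ P) :=
  (tensorLeftAdjunction (ᘁX) X).map_projective P hP

theorem projective_tensor_right (P X : C) [hP : Projective P] : Projective (P ⊗ X) :=
  (tensorRightAdjunction X (Xᘁ)).map_projective P hP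

/-- Under duality, lifting Pᘁ ⟶ X along an epimorphism e becomes lifting 𝟙 ⟶ P ⊗ X along P ◁ e,
which splits because P ⊗ X is projective. -/
theorem projective_rightDual (P : C) [Projective P] : Projective (Pᘁ) where
  factors {E X} f e _ := by
    have := projective_tensor_right P X
    have hs : Projective.factorThru (𝟙 (P ⊗ X)) (P ◁ e) ≫ P ◁ e = 𝟙 _ :=
      Projective.factorThru_comp _ _
    let g : 𝟙_ C ⟶ P ⊗ X := tensorLeftHomEquiv (𝟙_ C) P (Pᘁ) X ((ρ_ _).hom ≫ f)
    let g' : 𝟙_ C ⟶ P ⊗ E := g ≫ Projective.factorThru (𝟙 (P ⊗ X)) (P ◁ e)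
    have hg' : g' ≫ P ◁ e = g := by simp [g', hs]
    let h : Pᘁ ⊗ 𝟙_ C ⟶ E := (tensorLeftHomEquiv (𝟙_ C) P (Pᘁ) E).symm g'
    refine ⟨(ρ_ _).inv ≫ h, ?_⟩
    have hh : h ≫ e = (ρ_ _).hom ≫ f := by
      apply (tensorLeftHomEquiv (𝟙_ C) P (Pᘁ) X).injective
      rw [tensorLeftHomEquiv_naturality, Equiv.apply_symm_apply, hg']
    simp [hh]

variable [MonoidalPreadditive C]

/-- In a rigid abelian category, projective objects are injective. -/
theorem injective_of_projective (P : C) [Projective P] : Injective P where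
  factors {A B} g f _ := by
    have hP' := projective_rightDual P
    have hS : (ShortComplex.mk f (cokernel.π f) (by simp)).ShortExact :=
      ShortComplex.ShortExact.mk' (ShortComplex.exact_of_g_is_cokernel _ (cokernelIsCokernel f))
        inferInstance inferInstance
    -- Tensoring with the projective object Pᘁ makes the cokernel projective, so the sequence
    -- splits; the retraction extends the mate of g from Pᘁ ⊗ A to Pᘁ ⊗ B.
    have hS' := hS.map_of_exact (tensorLeft (Pᘁ))
    have : Projective ((ShortComplex.mk f (cokernel.π f) (by simp)).map (tensorLeft (Pᘁ))).X₃ :=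
      projective_tensor_right (Pᘁ) _
    obtain ⟨r, hr⟩ : ∃ r : Pᘁ ⊗ B ⟶ Pᘁ ⊗ A, Pᘁ ◁ f ≫ r = 𝟙 _ :=
      ⟨hS'.splittingOfProjective.r, hS'.splittingOfProjective.f_r⟩
    let e := tensorLeftHomEquiv A P (Pᘁ) (𝟙_ C)
    refine ⟨tensorLeftHomEquiv B P (Pᘁ) (𝟙_ C) (r ≫ e.symm (g ≫ (ρ_ P).inv)) ≫ (ρ_ P).hom, ?_⟩
    have h1 : f ≫ tensorLeftHomEquiv B P (Pᘁ) (𝟙_ C) (r ≫ e.symm (g ≫ (ρ_ P).inv)) =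
        g ≫ (ρ_ P).inv := by
      apply e.symm.injective
      have := tensorLeftHomEquiv_symm_naturality (Y := P) (Y' := Pᘁ) f
        (tensorLeftHomEquiv B P (Pᘁ) (𝟙_ C) (r ≫ e.symm (g ≫ (ρ_ P).inv)))
      rw [this, Equiv.symm_apply_apply, reassoc_of% hr]
    rw [reassoc_of% h1, Iso.inv_hom_id, Category.comp_id]

variable [Simple (𝟙_ C)]

/-- The evaluation X ⊗ ᘁX ⟶ 𝟙 is nonzero by the zigzag identity, hence epi as 𝟙 is simple; tensor it
with Z. -/
theorem exists_epi_tensor_right {X : C} (hX : ¬ IsZero X) (Z : C) :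
    ∃ (W : C) (f : X ⊗ W ⟶ Z), Epi f := by
  have h0 : ε_ (ᘁX) X ≠ 0 := by
    intro h
    have := ExactPairing.coevaluation_evaluation (ᘁX) X
    rw [h] at this
    have h1 : (ρ_ X).hom ≫ (λ_ X).inv = 0 := by
      rw [← this]
      simp
    refine hX ((IsZero.iff_id_eq_zero X).2 ?_)
    have h2 := congr((ρ_ X).inv ≫ $h1 ≫ (λ_ X).hom)
    simpa using h2
  have := epi_of_nonzero_to_simple h0
  exact ⟨(ᘁX : C) ⊗ Z, (α_ _ _ _).inv ≫ (ε_ (ᘁX) X) ▷ Z ≫ (λ_ Z).hom, inferInstance⟩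

theorem exists_epi_tensor_left {X : C} (hX : ¬ IsZero X) (Z : C) :
    ∃ (W : C) (f : W ⊗ X ⟶ Z), Epi f := by
  have h0 : ε_ X (Xᘁ) ≠ 0 := by
    intro h
    have := ExactPairing.evaluation_coevaluation X (Xᘁ)
    rw [h] at this
    have h1 : (λ_ X).hom ≫ (ρ_ X).inv = 0 := by
      rw [← this]
      simp
    refine hX ((IsZero.iff_id_eq_zero X).2 ?_)
    have h2 := congr((λ_ X).inv ≫ $h1 ≫ (ρ_ X).hom)
    simpa using h2
  have := epi_of_nonzero_to_simple h0
  exact ⟨Z ⊗ Xᘁ, (α_ _ _ _).hom ≫ Z ◁ (ε_ X (Xᘁ)) ≫ (ρ_ Z).hom, inferInstance⟩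

theorem not_isZero_tensor {X Y : C} (hX : ¬ IsZero X) (hY : ¬ IsZero Y) : ¬ IsZero (X ⊗ Y) := by
  intro h
  obtain ⟨W, f, hf⟩ := exists_epi_tensor_left hX (𝟙_ C)
  have h1 : Epi ((α_ W X Y).inv ≫ f ▷ Y ≫ (λ_ Y).hom) := inferInstance
  exact hY (IsZero.of_epi ((α_ W X Y).inv ≫ f ▷ Y ≫ (λ_ Y).hom) (isZero_tensor_left W h))

end Rigid

section LinearRigid

variable (k : Type w) [Field k] {C : Type u} [Category.{v} C] [Abelian C] [Linear k C]
  [MonoidalCategory C] [MonoidalPreadditive C] [MonoidalLinear k C]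

theorem homDim_tensor (X Y Y' Z : C) [ExactPairing Y Y'] :
    homDim k (Y' ⊗ X) Z = homDim k X (Y ⊗ Z) := by
  refine LinearEquiv.finrank_eq (R := k)
    { tensorLeftHomEquiv X Y Y' Z with
      map_add' := fun f g => ?_
      map_smul' := fun r f => ?_ }
  · simp [tensorLeftHomEquiv]
  · simp [tensorLeftHomEquiv]

end LinearRigid

/-! ### The Grothendieck group and its multiplication operators -/

section GrothendieckGroup

variable (k : Type w) [Field k] [IsAlgClosed k] {C : Type u} [Category.{v} C] [Abelian C]
  [Linear k C] [∀ X Y : C, FiniteDimensional k (X ⟶ Y)] [IsFiniteAbelian C]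

theorem grClass_apply (X : C) (i : SimpleClass C) : grClass X i = homDim k (proj i) X := by
  classical
  rw [← (hasFactors_factors X).count_eq k i, grClass]
  induction factors X using Multiset.induction with
  | empty => simp
  | cons j s ih =>
    rw [Multiset.map_cons, Multiset.sum_cons, Finsupp.add_apply, ih, Multiset.count_cons,
      Finsupp.single_apply]
    simp only [eq_comm (a := j)]
    split_ifs <;> push_cast <;> ring

include k in
theorem isAdditive_grClass : IsAdditive (grClass (C := C)) := fun S hS => by
  ext i
  simp [grClass_apply k, homDim_shortExact k _ hS]

include k in
theorem grClass_obj (i : SimpleClass C) : grClass i.obj = Finsupp.single i 1 := by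
  classical
  ext j
  rw [grClass_apply k, homDim_proj_simple, Finsupp.single_apply]
  simp [eq_comm]

theorem exists_homDim_proj_ne_zero {X : C} (hX : ¬ IsZero X) :
    ∃ i : SimpleClass C, homDim k (proj i) X ≠ 0 := by
  classical
  have h := hasFactors_factors X
  generalize factors X = s at h
  cases h with
  | zero h => exact absurd h hX
  | @cons A Y L s f g w hS hL hA =>
    refine ⟨IsoClass.mk L hL, ?_⟩
    rw [← (HasFactors.cons f g w hS hL hA).count_eq k]
    simp

include k in
-- The universal property of the Grothendieck group: linear maps defined on simples take the
-- expected value on every class.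
theorem linearCombination_grClass [Fintype (SimpleClass C)] {M : Type*} [AddCommGroup M] [Module ℝ M] {φ : C → M}
    (h : IsAdditive φ) (X : C) :
    Finsupp.linearCombination ℝ (fun i : SimpleClass C => φ i.obj) (grClass X) = φ X := by
  rw [h.eq_sum k X, Finsupp.linearCombination_apply, Finsupp.sum_fintype _ _ (by simp)]
  simp [grClass_apply k, Nat.cast_smul_eq_nsmul]

end GrothendieckGroup

theorem leftMul_single {C : Type u} [Category.{v} C] [Abelian C] [MonoidalCategory C]
    (X : C) (i : SimpleClass C) :
    leftMul X (Finsupp.single i 1) = grClass (X ⊗ i.obj) := by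
  simp [leftMul]

section LeftMul

variable (k : Type w) [Field k] [IsAlgClosed k] {C : Type u} [Category.{v} C] [Abelian C]
  [Linear k C] [MonoidalCategory C] [MonoidalPreadditive C] [RigidCategory C]
  [∀ X Y : C, FiniteDimensional k (X ⟶ Y)] [IsFiniteAbelian C]
  [Fintype (SimpleClass C)]

include k in
theorem leftMul_grClass (X Y : C) : leftMul X (grClass Y) = grClass (X ⊗ Y) :=
  linearCombination_grClass k ((isAdditive_grClass k).comp_functor (tensorLeft X)) Y

variable (C) in
/-- Right multiplication by the sum of all simple objects on the Grothendieck group. -/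
def rightMulSimples : Module.End ℝ (SimpleClass C →₀ ℝ) :=
  Finsupp.linearCombination ℝ fun i : SimpleClass C => ∑ j : SimpleClass C, grClass (i.obj ⊗ j.obj)

include k in
theorem rightMulSimples_grClass (X : C) :
    rightMulSimples C (grClass X) = ∑ j : SimpleClass C, grClass (X ⊗ j.obj) := by
  refine linearCombination_grClass k (φ := fun X => ∑ j : SimpleClass C, grClass (X ⊗ j.obj))
    (fun S hS => ?_) X
  dsimp only
  rw [← Finset.sum_add_distrib]
  exact Finset.sum_congr rfl fun j _ =>
    (isAdditive_grClass k).comp_functor (tensorRight j.obj) hS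

include k in
theorem leftMul_rightMulSimples (X : C) (w : SimpleClass C →₀ ℝ) :
    leftMul X (rightMulSimples C w) = rightMulSimples C (leftMul X w) := by
  suffices h : leftMul X ∘ₗ rightMulSimples C = rightMulSimples C ∘ₗ leftMul X from
    LinearMap.congr_fun h w
  ext1 i
  ext1
  dsimp
  rw [leftMul_single, rightMulSimples_grClass k, ← grClass_obj k, rightMulSimples_grClass k,
    map_sum]
  refine Finset.sum_congr rfl fun j _ => ?_
  rw [leftMul_grClass k]
  exact (isAdditive_grClass k).isSplitAdditive.iso (α_ _ _ _).symm

variable [Simple (𝟙_ C)]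

include k in
-- Some L_i ⊗ W maps onto L_j, so L_j already occurs in L_i ⊗ L_l for a constituent L_l of W: the
-- matrix has no zero entry.
theorem rightMulSimples_pos (w : SimpleClass C →₀ ℝ) (hw : ∀ i, 0 ≤ w i) (hne : w ≠ 0)
    (j : SimpleClass C) : 0 < rightMulSimples C w j := by
  have hnn : ∀ i l : SimpleClass C, 0 ≤ grClass (i.obj ⊗ l.obj) j := fun i l => by
    rw [grClass_apply k]
    positivity
  have key : ∀ i : SimpleClass C, 0 < ∑ l : SimpleClass C, grClass (i.obj ⊗ l.obj) j := by
    intro i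
    refine Finset.sum_pos' (fun l _ => hnn i l) ?_
    obtain ⟨W, f, hf⟩ := exists_epi_tensor_right (Simple.not_isZero i.obj) j.obj
    have h1 : homDim k (proj j) (i.obj ⊗ W) ≠ 0 := by
      refine (homDim_ne_zero_iff k).2 ⟨Projective.factorThru (projπ j) f, fun h => ?_⟩
      apply projπ_ne_zero j
      rw [← Projective.factorThru_comp (projπ j) f, h, zero_comp]
    have h2 := ((isAdditive_homDim k (proj j)).comp_functor (tensorLeft i.obj)).eq_sum k W
    dsimp at h2
    obtain ⟨l, hl, hl0⟩ := Finset.exists_ne_zero_of_sum_ne_zero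
      (h2.symm.trans_ne (Nat.cast_ne_zero.2 h1))
    refine ⟨l, hl, lt_of_le_of_ne (hnn i l) (Ne.symm ?_)⟩
    rw [grClass_apply k]
    exact right_ne_zero_of_smul hl0
  rw [rightMulSimples, Finsupp.linearCombination_apply, Finsupp.sum_fintype _ _ (by simp),
    Finsupp.finsetSum_apply]
  obtain ⟨i, hi⟩ := Finsupp.ne_iff.1 hne
  refine Finset.sum_pos' (fun i _ => ?_) ⟨i, Finset.mem_univ i, ?_⟩
  · simpa [Finsupp.finsetSum_apply] using mul_nonneg (hw i) (key i).le
  · simpa [Finsupp.finsetSum_apply] using mul_pos (lt_of_le_of_ne (hw i) (Ne.symm hi)) (key i)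

include k in
/-- The Frobenius–Perron dimensions are the eigenvalues of the left multiplications at a common
positive eigenvector. -/
theorem exists_leftMul_eq_fpDim_smul :
    ∃ v : SimpleClass C →₀ ℝ, (∀ i, 0 < v i) ∧ ∀ X : C, leftMul X v = fpDim X • v := by
  have : Nonempty (SimpleClass C) := ⟨IsoClass.mk (𝟙_ C) inferInstance⟩
  obtain ⟨v, hv, h⟩ := exists_common_eigenvector (rightMulSimples C) (rightMulSimples_pos k)
  refine ⟨v, hv, fun X => ?_⟩
  obtain ⟨d, hd⟩ := h (leftMul X) (leftMul_rightMulSimples k X)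
  have hg : IsGreatest {t : ℝ | (leftMul X).HasEigenvalue t} d := by
    refine isGreatest_eigenvalue_of_nonneg (leftMul X) (fun w hw i => ?_) hv hd
    rw [leftMul, Finsupp.linearCombination_apply, Finsupp.sum_fintype _ _ (by simp),
      Finsupp.finsetSum_apply]
    refine Finset.sum_nonneg fun j _ => ?_
    rw [Finsupp.smul_apply, grClass_apply k]
    exact mul_nonneg (hw j) (Nat.cast_nonneg _)
  rw [hd, fpDim, hg.csSup_eq]

end LeftMul

/-! ### Frobenius–Perron dimension as a positive character -/

section FPDim

variable (k : Type w) [Field k] [IsAlgClosed k] {C : Type u} [Category.{v} C] [Abelian C]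
  [Linear k C] [MonoidalCategory C] [MonoidalPreadditive C] [RigidCategory C]
  [∀ X Y : C, FiniteDimensional k (X ⟶ Y)] [IsFiniteAbelian C]
  [Simple (𝟙_ C)]

include k in
theorem isAdditive_fpDim : IsAdditive (fpDim (C := C)) := fun S hS => by
  have := Fintype.ofFinite (SimpleClass C)
  obtain ⟨v, hv, h⟩ := exists_leftMul_eq_fpDim_smul k (C := C)
  have h1 : leftMul S.X₂ = leftMul S.X₁ + leftMul S.X₃ := by
    ext1 i
    ext1
    dsimp
    simp only [leftMul_single]
    exact (isAdditive_grClass k).comp_functor (tensorRight i.obj) hS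
  have h2 : fpDim S.X₂ • v = (fpDim S.X₁ + fpDim S.X₃) • v := by
    rw [← h, h1, add_smul, ← h, ← h, LinearMap.add_apply]
  have h3 := congr($h2 (IsoClass.mk (𝟙_ C) inferInstance))
  exact mul_right_cancel₀ (hv _).ne' h3

include k in
theorem fpDim_tensor (X Y : C) : fpDim (X ⊗ Y) = fpDim X * fpDim Y := by
  have := Fintype.ofFinite (SimpleClass C)
  obtain ⟨v, hv, h⟩ := exists_leftMul_eq_fpDim_smul k (C := C)
  have h1 : leftMul (X ⊗ Y) = leftMul X ∘ₗ leftMul Y := by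
    ext1 i
    ext1
    dsimp
    simp only [leftMul_single]
    rw [leftMul_grClass k]
    exact (isAdditive_grClass k).isSplitAdditive.iso (α_ _ _ _)
  have h2 : fpDim (X ⊗ Y) • v = (fpDim X * fpDim Y) • v := by
    rw [← h, h1, LinearMap.comp_apply, h, map_smul, h, smul_smul, mul_comm]
  have h3 := congr($h2 (IsoClass.mk (𝟙_ C) inferInstance))
  exact mul_right_cancel₀ (hv _).ne' h3

include k in
theorem fpDim_pos {X : C} (hX : ¬ IsZero X) : 0 < fpDim X := by
  have := Fintype.ofFinite (SimpleClass C)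
  obtain ⟨v, hv, h⟩ := exists_leftMul_eq_fpDim_smul k (C := C)
  let o : SimpleClass C := IsoClass.mk (𝟙_ C) inferInstance
  obtain ⟨i, hi⟩ := exists_homDim_proj_ne_zero k (not_isZero_tensor hX (Simple.not_isZero o.obj))
  have h1 : 0 < leftMul X v i := by
    rw [leftMul, Finsupp.linearCombination_apply, Finsupp.sum_fintype _ _ (by simp),
      Finsupp.finsetSum_apply]
    refine Finset.sum_pos' (fun j _ => ?_) ⟨o, Finset.mem_univ o, ?_⟩
    · rw [Finsupp.smul_apply, grClass_apply k]
      exact mul_nonneg (hv j).le (Nat.cast_nonneg _)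
    · rw [Finsupp.smul_apply, grClass_apply k]
      exact mul_pos (hv o) (Nat.cast_pos.2 (Nat.pos_of_ne_zero hi))
  rw [h, Finsupp.smul_apply, smul_eq_mul] at h1
  exact pos_of_mul_pos_left h1 (hv i).le

include k in
theorem fpDim_nonneg (X : C) : 0 ≤ fpDim X := by
  by_cases hX : IsZero X
  · exact ((isAdditive_fpDim k).of_isZero hX).ge
  · exact (fpDim_pos k hX).le

include k in
theorem isZero_of_fpDim_eq_zero {X : C} (h : fpDim X = 0) : IsZero X := by
  by_contra hX
  exact (fpDim_pos k hX).ne' h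

include k in
theorem fpDim_unit : fpDim (𝟙_ C) = 1 := by
  have h1 := fpDim_tensor k (𝟙_ C) (𝟙_ C)
  rw [(isAdditive_fpDim k).isSplitAdditive.iso (λ_ (𝟙_ C))] at h1
  exact mul_left_cancel₀ (fpDim_pos k (Simple.not_isZero (𝟙_ C))).ne' (by rw [← h1, mul_one])

include k in
/-- The Frobenius–Perron dimension is the only positive character of the Grothendieck ring. -/
theorem eq_fpDim_of_isAdditive {χ : C → ℝ} (hχ : IsAdditive χ)
    (hmul : ∀ X Y : C, χ (X ⊗ Y) = χ X * χ Y) (hpos : ∀ X : C, ¬ IsZero X → 0 < χ X) (X : C) :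
    χ X = fpDim X := by
  have := Fintype.ofFinite (SimpleClass C)
  obtain ⟨v, hv, h⟩ := exists_leftMul_eq_fpDim_smul k (C := C)
  let L := Finsupp.linearCombination ℝ (fun i : SimpleClass C => χ i.obj)
  -- χ is an eigenvector of the transposed operator with eigenvalue χ X. Pairing with v, where the
  -- eigenvalue is `fpDim X`, forces equality because L v > 0.
  have h1 : L ∘ₗ leftMul X = χ X • L := by
    ext1 i
    ext1
    dsimp
    rw [leftMul_single, linearCombination_grClass k hχ, hmul]
    simp [L]
  have h2 : 0 < L v := by
    simp only [L]
    rw [Finsupp.linearCombination_apply, Finsupp.sum_fintype _ _ (by simp)]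
    exact Finset.sum_pos (fun i _ => mul_pos (hv i) (hpos _ (Simple.not_isZero i.obj)))
      ⟨IsoClass.mk (𝟙_ C) inferInstance, Finset.mem_univ _⟩
  have h3 := LinearMap.congr_fun h1 v
  rw [LinearMap.comp_apply, h, map_smul, LinearMap.smul_apply] at h3
  exact (mul_right_cancel₀ h2.ne' h3).symm

end FPDim

/-! ### The regular virtual projective object -/

theorem regularVirtual_eq (k : Type w) [Field k] [IsAlgClosed k] {C : Type u} [Category.{v} C]
    [Abelian C] [Linear k C] [MonoidalCategory C] [∀ X Y : C, FiniteDimensional k (X ⟶ Y)]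
    [IsFiniteAbelian C] [Fintype (SimpleClass C)] :
    regularVirtual C =
      ∑ i : SimpleClass C, ((fpDim i.obj : ℝ) : ℂ) • Finsupp.single (projIndec k i) 1 := by
  classical
  rw [regularVirtual, finsum_eq_sum_of_fintype]
  refine Finset.sum_congr rfl fun i _ => ?_
  rw [projClass_eq k, Finset.sum_eq_single i]
  · rw [homDim_proj_simple, if_pos rfl, Nat.cast_one]
  · intro j _ hj
    rw [homDim_proj_simple, if_neg hj.symm, Nat.cast_zero, Finsupp.single_zero]
  · simp

section Regular

variable (k : Type w) [Field k] [IsAlgClosed k] {C : Type u} [Category.{v} C] [Abelian C]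
  [Linear k C] [MonoidalCategory C] [MonoidalPreadditive C] [RigidCategory C]
  [Simple (𝟙_ C)] [∀ X Y : C, FiniteDimensional k (X ⟶ Y)] [IsFiniteAbelian C]
  [Fintype (SimpleClass C)]

include k in
theorem catFPDim_eq :
    catFPDim C = ((∑ i : SimpleClass C, fpDim i.obj * fpDim (proj i) : ℝ) : ℂ) := by
  rw [catFPDim, regularVirtual_eq k, map_sum]
  push_cast
  refine Finset.sum_congr rfl fun i _ => ?_
  obtain ⟨e⟩ := nonempty_projIndec_obj_iso k i
  rw [map_smul, virtualFPDim, Finsupp.linearCombination_single, one_smul, smul_eq_mul,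
    (isAdditive_fpDim k).isSplitAdditive.iso e]

variable (C) in
include k in
theorem sum_fpDim_mul_fpDim_proj_pos :
    0 < ∑ i : SimpleClass C, fpDim i.obj * fpDim (proj i) :=
  Finset.sum_pos (fun i _ => mul_pos (fpDim_pos k (Simple.not_isZero i.obj))
      (fpDim_pos k (indecomposable_proj k i).1))
    ⟨IsoClass.mk (𝟙_ C) inferInstance, Finset.mem_univ _⟩

variable [MonoidalLinear k C]

include k in
-- By adjunction the multiplicity of P_i in X ⊗ P_j is that of L_j in ᘁX ⊗ L_i; weighting by d₊(L_j)
-- and summing gives d₊(ᘁX) d₊(L_i). The test function φ replaces an identity in K(C).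
theorem sum_fpDim_mul_tensor_proj_leftDual {φ : C → ℝ} (h : IsSplitAdditive φ) (X : C) :
    ∑ j : SimpleClass C, fpDim j.obj * φ (X ⊗ proj j) =
      fpDim (ᘁX : C) * ∑ i : SimpleClass C, fpDim i.obj * φ (proj i) := by
  have h1 : ∀ j : SimpleClass C, φ (X ⊗ proj j) =
      ∑ i : SimpleClass C, homDim k (proj j) ((ᘁX : C) ⊗ i.obj) * φ (proj i) := fun j => by
    have := projective_tensor_left X (proj j)
    rw [h.eq_sum k (X ⊗ proj j)]
    simp_rw [homDim_tensor k (proj j) (ᘁX : C) X, nsmul_eq_mul]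
  simp_rw [h1, Finset.mul_sum]
  rw [Finset.sum_comm]
  refine Finset.sum_congr rfl fun i _ => ?_
  rw [← mul_assoc, ← fpDim_tensor k, (isAdditive_fpDim k).eq_sum k ((ᘁX : C) ⊗ i.obj),
    Finset.sum_mul]
  refine Finset.sum_congr rfl fun j _ => ?_
  rw [nsmul_eq_mul]
  ring

omit [Fintype (SimpleClass C)] in
include k in
-- Apply the preceding identity to φ = d₊: by multiplicativity its left side is d₊(X) times the same
-- positive sum.
theorem fpDim_leftDual (X : C) : fpDim (ᘁX : C) = fpDim X := by
  have := Fintype.ofFinite (SimpleClass C)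
  have h := sum_fpDim_mul_tensor_proj_leftDual k (isAdditive_fpDim k (C := C)).isSplitAdditive X
  simp_rw [fpDim_tensor k, mul_left_comm _ (fpDim X), ← Finset.mul_sum] at h
  exact (mul_right_cancel₀ (sum_fpDim_mul_fpDim_proj_pos k C).ne' h).symm

include k in
/-- Tensoring the regular virtual projective object with `X` multiplies it by `d₊(X)`. -/
theorem sum_fpDim_mul_tensor_proj {φ : C → ℝ} (h : IsSplitAdditive φ) (X : C) :
    ∑ j : SimpleClass C, fpDim j.obj * φ (X ⊗ proj j) =
      fpDim X * ∑ i : SimpleClass C, fpDim i.obj * φ (proj i) := by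
  rw [sum_fpDim_mul_tensor_proj_leftDual k h, fpDim_leftDual k]

end Regular

/-! ### Projective summands and the projectivity defect -/

theorem rightComp_kernel_ι_injective (k : Type w) [Field k] {C : Type u}
    [Category.{v} C] [Abelian C] [Linear k C] [IsFiniteAbelian C] (i : SimpleClass C) (X : C) :
    Function.Injective (Linear.rightComp k X (kernel.ι (projπ i))) :=
  fun _ _ h => (cancel_mono (kernel.ι (projπ i))).1 h

section Defect

variable (k : Type w) [Field k] {C : Type u} [Category.{v} C] [Abelian C]
  [Linear k C] [∀ X Y : C, FiniteDimensional k (X ⟶ Y)] [IsFiniteAbelian C]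

/-- The multiplicity of the projective cover of `L_i` as a direct summand of `X`, computed as the
dimension of the space of morphisms `X ⟶ L_i` that factor through `P_i`. -/
def summandMult (i : SimpleClass C) (X : C) : ℝ :=
  homDim k X (proj i) - homDim k X (kernel (projπ i))

theorem isSplitAdditive_summandMult (i : SimpleClass C) : IsSplitAdditive (summandMult k i) where
  iso e := by simp [summandMult, homDim_congr k e (Iso.refl _)]
  biprod X Y := by
    simp only [summandMult, homDim_biprod]
    push_cast
    ring

theorem summandMult_of_projective (i : SimpleClass C) (P : C) [Projective P] :
    summandMult k i P = homDim k P i.obj := by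
  have hS : (ShortComplex.mk (kernel.ι (projπ i)) (projπ i) (by simp)).ShortExact :=
    ShortComplex.ShortExact.mk' (ShortComplex.exact_of_f_is_kernel _ (kernelIsKernel _))
      inferInstance inferInstance
  have := homDim_shortExact k P hS
  dsimp at this
  rw [summandMult, this]
  push_cast
  ring

theorem summandMult_nonneg (i : SimpleClass C) (X : C) : 0 ≤ summandMult k i X :=
  sub_nonneg.2 (Nat.cast_le.2
    (LinearMap.finrank_le_finrank_of_injective (rightComp_kernel_ι_injective k i X)))

/-- The number is the codimension of Hom(X, ker π_i) in Hom(X, P_i), which is zero exactly when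
every X ⟶ P_i lands in the kernel of π_i. -/
theorem summandMult_ne_zero_iff (i : SimpleClass C) (X : C) :
    summandMult k i X ≠ 0 ↔ ∃ g : X ⟶ proj i, g ≫ projπ i ≠ 0 := by
  have h := LinearMap.injective_iff_surjective_of_finrank_eq_finrank (K := k)
    (f := Linear.rightComp k X (kernel.ι (projπ i)))
  rw [← not_iff_not, not_not, summandMult, sub_eq_zero, Nat.cast_inj]
  push Not
  constructor
  · intro heq g
    obtain ⟨f, rfl⟩ := (h heq.symm).1 (rightComp_kernel_ι_injective k i X) g
    change (f ≫ kernel.ι _) ≫ _ = 0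
    simp
  · intro hg
    refine (LinearEquiv.finrank_eq (LinearEquiv.ofBijective
      (Linear.rightComp k X (kernel.ι (projπ i)))
      ⟨rightComp_kernel_ι_injective k i X, fun g => ⟨kernel.lift _ g (hg g), ?_⟩⟩)).symm
    exact kernel.lift_ι _ _ _

/-- Every object is the direct sum of a projective object and an object without projective
summands. -/
theorem exists_biprod_iso_summandMult_eq_zero (X : C) :
    ∃ Q Y : C, Projective Q ∧ Nonempty (X ≅ Q ⊞ Y) ∧
      ∀ i : SimpleClass C, summandMult k i Y = 0 := by
  have := Fintype.ofFinite (SimpleClass C)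
  obtain ⟨n, hn⟩ : ∃ n, ∑ i : SimpleClass C, homDim k X (proj i) ≤ n := ⟨_, le_rfl⟩
  induction n generalizing X with
  | zero =>
    refine ⟨0, X, inferInstance, ⟨(isoZeroBiprod (isZero_zero C))⟩, fun i => ?_⟩
    by_contra h
    obtain ⟨g, hg⟩ := (summandMult_ne_zero_iff k i X).1 h
    have h1 := (Finset.sum_eq_zero_iff.1 (Nat.le_zero.1 hn)) i (Finset.mem_univ i)
    refine (homDim_ne_zero_iff k).2 ⟨g, fun h0 => hg ?_⟩ h1
    rw [h0, zero_comp]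
  | succ n ih =>
    by_cases h : ∀ i : SimpleClass C, summandMult k i X = 0
    · exact ⟨0, X, inferInstance, ⟨(isoZeroBiprod (isZero_zero C))⟩, h⟩
    push Not at h
    obtain ⟨i, hi⟩ := h
    obtain ⟨g, hg⟩ := (summandMult_ne_zero_iff k i X).1 hi
    obtain ⟨X', ⟨e⟩⟩ := exists_biprod_proj_iso g hg
    have hlt : ∑ j : SimpleClass C, homDim k X' (proj j) <
        ∑ j : SimpleClass C, homDim k X (proj j) := by
      simp_rw [homDim_congr k e (Iso.refl _), homDim_biprod, Finset.sum_add_distrib]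
      refine Nat.lt_add_of_pos_right (Finset.sum_pos' (fun _ _ => Nat.zero_le _)
        ⟨i, Finset.mem_univ i, Nat.pos_of_ne_zero ?_⟩)
      refine (homDim_ne_zero_iff k).2 ⟨𝟙 _, fun h0 => projπ_ne_zero i ?_⟩
      rw [← Category.id_comp (projπ i), h0, zero_comp]
    obtain ⟨Q, Y, hQ, ⟨e'⟩, hY⟩ := ih X' (by omega)
    refine ⟨proj i ⊞ Q, Y, inferInstance, ⟨?_⟩, hY⟩
    exact e.trans ((biprod.mapIso e' (Iso.refl _)).trans
      ((biprod.braiding _ _).trans (biprod.associator _ _ _).symm))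

variable [IsAlgClosed k] [MonoidalCategory C] [MonoidalPreadditive C] [RigidCategory C]
  [Simple (𝟙_ C)] [Fintype (SimpleClass C)]

/-- The projectivity defect of `X`: the Frobenius–Perron dimension of the complement of its largest
projective direct summand. -/
def projDefect (X : C) : ℝ :=
  fpDim X - ∑ i : SimpleClass C, fpDim (proj i) * summandMult k i X

theorem isSplitAdditive_projDefect : IsSplitAdditive (projDefect (C := C) k) where
  iso e := by
    simp only [projDefect, (isSplitAdditive_summandMult k _).iso e,
      (isAdditive_fpDim k).isSplitAdditive.iso e]
  biprod X Y := by
    simp only [projDefect, (isSplitAdditive_summandMult k _).biprod,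
      (isAdditive_fpDim k).isSplitAdditive.biprod, mul_add, Finset.sum_add_distrib]
    ring

theorem projDefect_of_projective (P : C) [Projective P] : projDefect k P = 0 := by
  rw [projDefect, (isAdditive_fpDim k).isSplitAdditive.eq_sum k P, sub_eq_zero]
  refine Finset.sum_congr rfl fun i _ => ?_
  rw [summandMult_of_projective, nsmul_eq_mul, mul_comm]

theorem projDefect_le_fpDim (X : C) : projDefect k X ≤ fpDim X :=
  sub_le_self _ (Finset.sum_nonneg fun _ _ =>
    mul_nonneg (fpDim_nonneg k _) (summandMult_nonneg k _ _))

theorem exists_biprod_iso_projDefect_eq (X : C) :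
    ∃ Q Y : C, Projective Q ∧ Nonempty (X ≅ Q ⊞ Y) ∧ projDefect k X = fpDim Y := by
  obtain ⟨Q, Y, hQ, ⟨e⟩, hY⟩ := exists_biprod_iso_summandMult_eq_zero k X
  refine ⟨Q, Y, hQ, ⟨e⟩, ?_⟩
  rw [(isSplitAdditive_projDefect k).iso e, (isSplitAdditive_projDefect k).biprod,
    projDefect_of_projective, zero_add, projDefect]
  simp [hY]

theorem projDefect_nonneg (X : C) : 0 ≤ projDefect k X := by
  obtain ⟨Q, Y, -, -, h⟩ := exists_biprod_iso_projDefect_eq k X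
  exact h ▸ fpDim_nonneg k Y

theorem projective_of_projDefect_eq_zero {X : C} (h : projDefect k X = 0) : Projective X := by
  obtain ⟨Q, Y, hQ, ⟨e⟩, hXY⟩ := exists_biprod_iso_projDefect_eq k X
  have hY := (isZero_of_fpDim_eq_zero k (hXY.symm.trans h)).projective
  exact Projective.of_iso e.symm inferInstance

/-- Projectives form a two-sided tensor ideal, so only the product of the two non-projective
complements can contribute. -/
theorem projDefect_tensor_le (X Y : C) :
    projDefect k (X ⊗ Y) ≤ projDefect k X * projDefect k Y := by
  obtain ⟨Q, X', hQ, ⟨e⟩, hX⟩ := exists_biprod_iso_projDefect_eq k X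
  obtain ⟨R, Y', hR, ⟨f⟩, hY⟩ := exists_biprod_iso_projDefect_eq k Y
  have h1 := (isSplitAdditive_projDefect k).comp_functor (tensorRight Y)
  have h2 := (isSplitAdditive_projDefect k).comp_functor (tensorLeft X')
  have h3 : projDefect k (X ⊗ Y) = projDefect k (Q ⊗ Y) + projDefect k (X' ⊗ Y) :=
    (h1.iso e).trans (h1.biprod Q X')
  have h4 : projDefect k (X' ⊗ Y) = projDefect k (X' ⊗ R) + projDefect k (X' ⊗ Y') :=
    (h2.iso f).trans (h2.biprod R Y')
  have := projective_tensor_right Q Y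
  have := projective_tensor_left X' R
  rw [h3, h4, projDefect_of_projective, projDefect_of_projective, zero_add, zero_add, hX, hY,
    ← fpDim_tensor k]
  exact projDefect_le_fpDim k _

end Defect

/-! ### Consequences of surjectivity -/

section EnoughProjectives

variable {C : Type u} [Category.{v} C] [Abelian C] [MonoidalCategory C] [RigidCategory C]
  [Simple (𝟙_ C)] [IsFiniteAbelian C]

theorem exists_projective_epi (X : C) : ∃ (P : C) (e : P ⟶ X), Projective P ∧ Epi e := by
  let o : SimpleClass C := IsoClass.mk (𝟙_ C) inferInstance
  obtain ⟨f⟩ : Nonempty (o.obj ≅ 𝟙_ C) := IsoClass.obj_mk _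
  exact ⟨X ⊗ proj o, X ◁ (projπ o ≫ f.hom) ≫ (ρ_ X).hom, projective_tensor_left X (proj o),
    inferInstance⟩

end EnoughProjectives

section Surjective

variable {C : Type u} [Category.{v} C] [Abelian C] [MonoidalCategory C] [RigidCategory C]
  [Simple (𝟙_ C)] [IsFiniteAbelian C]
  {D : Type u'} [Category.{v'} D] [Abelian D] [MonoidalCategory D] [MonoidalPreadditive D]
  [RigidCategory D] {F : C ⥤ D}

/-- Every projective object is a retract of the image of a projective object. -/
theorem IsSurjective.exists_retract (hF : IsQuasiTensor F) (hs : IsSurjective F) (Q : D)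
    [Projective Q] : ∃ P : C, Projective P ∧ Nonempty (Retract Q (F.obj P)) := by
  have := hF.right_exact
  obtain ⟨X, Z, i, q, hi, hq⟩ := hs Q
  obtain ⟨P, e, hP, he⟩ := exists_projective_epi X
  -- The pullback maps onto Z because F(e) is epi, so Q lifts to it; the resulting mono Q ⟶ F(P)
  -- splits because Q is injective.
  let s : Q ⟶ pullback i (F.map e) :=
    Projective.factorThru (𝟙 Q) (pullback.fst i (F.map e) ≫ q)
  have hsq : s ≫ pullback.fst i (F.map e) ≫ q = 𝟙 Q := Projective.factorThru_comp _ _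
  have hsm : Mono s := mono_of_mono_fac hsq
  have hm : Mono (s ≫ pullback.snd i (F.map e)) := inferInstance
  have hQ := injective_of_projective Q
  exact ⟨P, hP, ⟨⟨s ≫ pullback.snd i (F.map e),
    Injective.factorThru (𝟙 Q) (s ≫ pullback.snd i (F.map e)), Injective.comp_factorThru _ _⟩⟩⟩

variable (k : Type w) [Field k] [IsAlgClosed k] [Linear k D] [MonoidalLinear k D]
  [Simple (𝟙_ D)] [∀ X Y : D, FiniteDimensional k (X ⟶ Y)] [IsFiniteAbelian D]

/-- By adjunction a nonzero map F(X) ⊗ P_j ⟶ L_i is wanted. Some W ⊗ P_j maps onto L_i, and W is a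
quotient of a projective, itself a retract of an F(X). -/
theorem IsSurjective.exists_homDim_leftDual_tensor_ne_zero (hs : IsSurjective F)
    (hF : IsQuasiTensor F) (i j : SimpleClass D) :
    ∃ X : C, homDim k (proj j) ((ᘁ(F.obj X) : D) ⊗ i.obj) ≠ 0 := by
  obtain ⟨W, f, hf⟩ := exists_epi_tensor_left (indecomposable_proj k j).1 i.obj
  obtain ⟨Z, e, hZ, he⟩ := exists_projective_epi W
  obtain ⟨X, -, ⟨r⟩⟩ := hs.exists_retract hF Z
  refine ⟨X, ?_⟩
  have hr : Epi r.r := epi_of_epi_fac r.retract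
  rw [← homDim_tensor k _ (ᘁ(F.obj X) : D) (F.obj X)]
  refine (homDim_ne_zero_iff k).2 ⟨r.r ▷ proj j ≫ e ▷ proj j ≫ f, fun h => ?_⟩
  have h1 : Epi (r.r ▷ proj j ≫ e ▷ proj j ≫ f) := inferInstance
  rw [h] at h1
  exact Simple.not_isZero i.obj (IsZero.of_epi_zero (F.obj X ⊗ proj j) i.obj)

end Surjective

/-! ### Quasi-tensor functors: projectivity and proportionality -/

section QuasiTensor

variable (k : Type w) [Field k] [IsAlgClosed k]
  {C : Type u} [Category.{v} C] [Abelian C] [Linear k C] [MonoidalCategory C]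
  [MonoidalPreadditive C] [RigidCategory C] [Simple (𝟙_ C)]
  [∀ X Y : C, FiniteDimensional k (X ⟶ Y)] [IsFiniteAbelian C]
  {D : Type u'} [Category.{v'} D] [Abelian D] [Linear k D] [MonoidalCategory D]
  [MonoidalPreadditive D] [RigidCategory D] [Simple (𝟙_ D)]
  [∀ X Y : D, FiniteDimensional k (X ⟶ Y)] [IsFiniteAbelian D]
  {F : C ⥤ D}

include k in
-- d₊ ∘ F is again a positive character; faithfulness gives positivity.
theorem IsQuasiTensor.fpDim_map (hF : IsQuasiTensor F) (X : C) : fpDim (F.obj X) = fpDim X := by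
  have := hF.additive
  have := hF.left_exact
  have := hF.right_exact
  have := hF.faithful
  refine eq_fpDim_of_isAdditive k (χ := fun X => fpDim (F.obj X))
    ((isAdditive_fpDim k).comp_functor F) (fun X Y => ?_) (fun X hX => fpDim_pos k fun h => hX ?_) X
  · obtain ⟨e⟩ := hF.tensor X Y
    rw [← fpDim_tensor k, (isAdditive_fpDim k).isSplitAdditive.iso e]
  · rw [IsZero.iff_id_eq_zero]
    apply F.map_injective
    exact h.eq_of_src _ _

variable [MonoidalLinear k C]

include k in
/-- A surjective quasi-tensor functor preserves projective objects. -/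
theorem IsQuasiTensor.projective_map (hF : IsQuasiTensor F) (hs : IsSurjective F) (P : C)
    (hP : Projective P) : Projective (F.obj P) := by
  have := Fintype.ofFinite (SimpleClass C)
  have := Fintype.ofFinite (SimpleClass D)
  have := hF.additive
  have hadd := (isSplitAdditive_projDefect (C := D) k).comp_functor F
  set S : ℝ := ∑ j : SimpleClass C, fpDim j.obj * projDefect k (F.obj (proj j)) with hS
  -- P_i ⊗ R_C = d₊(P_i) R_C, combined with submultiplicativity of the defect.
  have hle : ∀ i : SimpleClass C, fpDim (proj i) * S ≤ projDefect k (F.obj (proj i)) * S := by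
    intro i
    rw [← sum_fpDim_mul_tensor_proj k hadd (proj i), hS, Finset.mul_sum]
    refine Finset.sum_le_sum fun j _ => ?_
    obtain ⟨e⟩ := hF.tensor (proj i) (proj j)
    rw [← (isSplitAdditive_projDefect k).iso e, mul_left_comm]
    exact mul_le_mul_of_nonneg_left (projDefect_tensor_le k _ _) (fpDim_nonneg k _)
  have hnn : ∀ j : SimpleClass C, 0 ≤ fpDim j.obj * projDefect k (F.obj (proj j)) := fun j =>
    mul_nonneg (fpDim_nonneg k _) (projDefect_nonneg k _)
  have hS0 : S = 0 := by
    by_contra hne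
    have hSpos : 0 < S := lt_of_le_of_ne (Finset.sum_nonneg fun j _ => hnn j) (Ne.symm hne)
    have hzero : ∀ (i : SimpleClass C) (l : SimpleClass D),
        summandMult k l (F.obj (proj i)) = 0 := by
      intro i l
      have h1 := le_of_mul_le_mul_right (hle i) hSpos
      -- Now the defect of F(P_i) is at least its full dimension, so the subtracted sum of
      -- nonnegative terms vanishes.
      rw [projDefect, hF.fpDim_map k] at h1
      have hterm : ∀ l : SimpleClass D,
          0 ≤ fpDim (proj l) * summandMult k l (F.obj (proj i)) := fun l =>
        mul_nonneg (fpDim_nonneg k _) (summandMult_nonneg k _ _)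
      have h2 := Finset.single_le_sum (fun l _ => hterm l) (Finset.mem_univ l)
      have h3 : fpDim (proj l) * summandMult k l (F.obj (proj i)) = 0 :=
        le_antisymm (by linarith) (hterm l)
      exact (mul_eq_zero.1 h3).resolve_left (fpDim_pos k (indecomposable_proj k l).1).ne'
    let o : SimpleClass D := IsoClass.mk (𝟙_ D) inferInstance
    -- The cover of the unit of D is a summand of some F(Q), contradicting the absence of projective
    -- summands in all F(P_i).
    obtain ⟨Q, hQ, ⟨r⟩⟩ := hs.exists_retract hF (proj o)
    have h1 : summandMult k o (F.obj Q) ≠ 0 := by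
      refine (summandMult_ne_zero_iff k o _).2 ⟨r.r, fun h => projπ_ne_zero o ?_⟩
      rw [← Category.id_comp (projπ o), ← r.retract, Category.assoc, h, comp_zero]
    have h2 := ((isSplitAdditive_summandMult k o).comp_functor F).eq_sum k Q
    simp only [hzero, smul_zero, Finset.sum_const_zero] at h2
    exact h1 h2
  have hproj : ∀ j : SimpleClass C, Projective (F.obj (proj j)) := by
    intro j
    have h1 := (Finset.sum_eq_zero_iff_of_nonneg fun j _ => hnn j).1 hS0 j (Finset.mem_univ j)
    exact projective_of_projDefect_eq_zero k
      ((mul_eq_zero.1 h1).resolve_left (fpDim_pos k (Simple.not_isZero j.obj)).ne')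
  refine projective_induction k (motive := fun P => Projective (F.obj P))
    (fun X Y e hX => Projective.of_iso (F.mapIso e) hX) (fun X hX => (F.map_isZero hX).projective)
    (fun X i _ hX => ?_) P hP
  have := hproj i
  have := preservesBinaryBiproducts_of_preservesBiproducts F
  exact Projective.of_iso (F.mapBiprod X (proj i)).symm inferInstance

/-- The pairing of the image of the regular virtual projective object with `Y`. -/
def regularPairing [Fintype (SimpleClass C)] (F : C ⥤ D) (Y : D) : ℝ :=
  ∑ j : SimpleClass C, fpDim j.obj * homDim k (F.obj (proj j)) Y

variable [Fintype (SimpleClass C)]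

theorem isAdditive_regularPairing (hF : IsQuasiTensor F) (hs : IsSurjective F) :
    IsAdditive (regularPairing k F) := fun T hT => by
  simp only [regularPairing]
  rw [← Finset.sum_add_distrib]
  refine Finset.sum_congr rfl fun j _ => ?_
  have := hF.projective_map k hs (proj j) inferInstance
  rw [homDim_shortExact k _ hT]
  push_cast
  ring

/-- Both sides are the dimension of F(R_C), computed in D and in C; this fixes the proportionality
constant. -/
theorem IsQuasiTensor.sum_regularPairing [Fintype (SimpleClass D)] (hF : IsQuasiTensor F)
    (hs : IsSurjective F) :
    ∑ i : SimpleClass D, regularPairing k F i.obj * fpDim (proj i) =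
      ∑ j : SimpleClass C, fpDim j.obj * fpDim (proj j) := by
  simp_rw [regularPairing, Finset.sum_mul]
  rw [Finset.sum_comm]
  refine Finset.sum_congr rfl fun j _ => ?_
  have := hF.projective_map k hs (proj j) inferInstance
  rw [← hF.fpDim_map k (proj j),
    (isAdditive_fpDim k).isSplitAdditive.eq_sum k (F.obj (proj j)), Finset.mul_sum]
  refine Finset.sum_congr rfl fun i _ => ?_
  rw [nsmul_eq_mul, mul_assoc]

variable [MonoidalLinear k D]

omit [Simple (𝟙_ D)] [IsFiniteAbelian D] in
-- Move ᘁF(X) across Hom to get F(X) ⊗ F(P_j) ≅ F(X ⊗ P_j), then use X ⊗ R_C = d₊(X) R_C.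
theorem regularPairing_leftDual_tensor (hF : IsQuasiTensor F) (X : C) (Y : D) :
    regularPairing k F ((ᘁ(F.obj X) : D) ⊗ Y) = fpDim X * regularPairing k F Y := by
  have := hF.additive
  rw [regularPairing, regularPairing,
    ← sum_fpDim_mul_tensor_proj k ((isSplitAdditive_homDim k Y).comp_functor F) X]
  refine Finset.sum_congr rfl fun j _ => ?_
  obtain ⟨e⟩ := hF.tensor X (proj j)
  rw [← homDim_congr k e (Iso.refl _), homDim_tensor k _ (ᘁ(F.obj X) : D) (F.obj X)]

/-- The multiplicities of the indecomposable projective objects in the image of the regular virtual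
projective object are proportional to the Frobenius–Perron dimensions. -/
theorem exists_regularPairing_eq (hF : IsQuasiTensor F) (hs : IsSurjective F) :
    ∃ c : ℝ, ∀ Y : D, regularPairing k F Y = c * fpDim Y := by
  have := Fintype.ofFinite (SimpleClass D)
  have hne : (Finset.univ : Finset (SimpleClass D)).Nonempty :=
    ⟨IsoClass.mk (𝟙_ D) inferInstance, Finset.mem_univ _⟩
  obtain ⟨i, -, hi⟩ := Finset.exists_min_image Finset.univ
    (fun i : SimpleClass D => regularPairing k F i.obj / fpDim i.obj) hne
  have hpos : ∀ j : SimpleClass D, 0 < fpDim j.obj := fun j => fpDim_pos k (Simple.not_isZero j.obj)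
  set c := regularPairing k F i.obj / fpDim i.obj with hc
  have hci : regularPairing k F i.obj - c * fpDim i.obj = 0 := by
    rw [hc, div_mul_cancel₀ _ (hpos i).ne', sub_self]
  have hadd : IsAdditive fun Y : D => regularPairing k F Y - c * fpDim Y := fun T hT => by
    dsimp only
    rw [isAdditive_regularPairing k hF hs hT, isAdditive_fpDim k hT]
    ring
  have hnn : ∀ j : SimpleClass D, 0 ≤ regularPairing k F j.obj - c * fpDim j.obj := fun j =>
    sub_nonneg.2 ((le_div_iff₀ (hpos j)).1 (hi j (Finset.mem_univ j)))
  have hzero : ∀ j : SimpleClass D, regularPairing k F j.obj - c * fpDim j.obj = 0 := by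
    intro j
    -- The difference vanishes at L_i, hence at ᘁF(X) ⊗ L_i; being nonnegative on simples it
    -- vanishes at every constituent, and X is chosen so that L_j is one.
    obtain ⟨X, hX⟩ := hs.exists_homDim_leftDual_tensor_ne_zero k hF i j
    have h1 := hadd.eq_sum k ((ᘁ(F.obj X) : D) ⊗ i.obj)
    rw [regularPairing_leftDual_tensor k hF, fpDim_tensor k, fpDim_leftDual k, hF.fpDim_map k,
      mul_left_comm, ← mul_sub, hci, mul_zero] at h1
    have h2 := (Finset.sum_eq_zero_iff_of_nonneg fun j _ => nsmul_nonneg (hnn j) _).1 h1.symm j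
      (Finset.mem_univ j)
    exact (smul_eq_zero.1 h2).resolve_left hX
  refine ⟨c, fun Y => ?_⟩
  have h1 := hadd.eq_sum k Y
  simp only [hzero, smul_zero, Finset.sum_const_zero] at h1
  exact sub_eq_zero.1 h1

theorem IsQuasiTensor.regularPairing_eq [Fintype (SimpleClass D)] (hF : IsQuasiTensor F)
    (hs : IsSurjective F) (Y : D) :
    regularPairing k F Y = (∑ j : SimpleClass C, fpDim j.obj * fpDim (proj j)) /
      (∑ i : SimpleClass D, fpDim i.obj * fpDim (proj i)) * fpDim Y := by
  obtain ⟨c, hc⟩ := exists_regularPairing_eq k hF hs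
  have h := hF.sum_regularPairing k hs
  simp_rw [hc, mul_assoc, ← Finset.mul_sum] at h
  rw [hc, ← h, mul_div_cancel_right₀ _ (sum_fpDim_mul_fpDim_proj_pos k D).ne']

omit [Fintype (SimpleClass C)] in
include k in
theorem IsQuasiTensor.mapVirtual_regularVirtual (hF : IsQuasiTensor F) (hs : IsSurjective F) :
    mapVirtual F (regularVirtual C) = (catFPDim C / catFPDim D) • regularVirtual D := by
  have := Fintype.ofFinite (SimpleClass C)
  have := Fintype.ofFinite (SimpleClass D)
  rw [regularVirtual_eq k, regularVirtual_eq k, catFPDim_eq k, catFPDim_eq k, map_sum,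
    Finset.smul_sum]
  have h1 : ∀ j : SimpleClass C, mapVirtual F (Finsupp.single (projIndec k j) 1) =
      ∑ i : SimpleClass D,
        Finsupp.single (projIndec k i) (homDim k (F.obj (proj j)) i.obj : ℂ) := fun j => by
    obtain ⟨e⟩ := nonempty_projIndec_obj_iso k j
    have h2 := hF.projective_map k hs (projIndec k j).obj (projIndec k j).obj_prop.2
    rw [mapVirtual, Finsupp.linearCombination_single, one_smul, projClass_eq k]
    simp_rw [homDim_congr k (F.mapIso e) (Iso.refl _)]
  simp_rw [map_smul, h1, Finset.smul_sum, Finsupp.smul_single]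
  rw [Finset.sum_comm]
  refine Finset.sum_congr rfl fun i _ => ?_
  rw [← Finsupp.single_finsetSum]
  congr 1
  have h2 := congrArg (fun x : ℝ => (x : ℂ)) (hF.regularPairing_eq k hs i.obj)
  simp only [regularPairing] at h2
  push_cast at h2 ⊢
  simp only [smul_eq_mul, mul_one]
  exact h2

end QuasiTensor

/-! ### Integral dimensions and freeness -/

section RegularObject

variable {C : Type u} [Category.{v} C] [Abelian C] [MonoidalCategory C] [IsFiniteAbelian C]

instance projective_regularObj : Projective (regularObj C) :=
  have := Fintype.ofFinite (SimpleClass C)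
  projective_biproduct _ fun _ => inferInstance

theorem homDim_regularObj (k : Type w) [Field k] [IsAlgClosed k] [Linear k C]
    [∀ X Y : C, FiniteDimensional k (X ⟶ Y)] (j : SimpleClass C) :
    homDim k (regularObj C) j.obj = ⌊fpDim j.obj⌋₊ := by
  classical
  have := Fintype.ofFinite (SimpleClass C)
  rw [regularObj, homDim_biproduct]
  simp_rw [homDim_proj_simple]
  rw [Fintype.sum_sigma]
  simp [apply_ite Finset.card]

end RegularObject

section Integrality

variable (k : Type w) [Field k] [IsAlgClosed k] {C : Type u} [Category.{v} C] [Abelian C]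
  [Linear k C] [MonoidalCategory C] [MonoidalPreadditive C] [RigidCategory C]
  [Simple (𝟙_ C)] [∀ X Y : C, FiniteDimensional k (X ⟶ Y)] [IsFiniteAbelian C]

include k in
-- Multiplication by d₊(X) preserves the nonzero finitely generated subgroup of ℝ spanned by the
-- d₊(L_i).
theorem isIntegral_fpDim (X : C) : IsIntegral ℤ (fpDim X) := by
  have := Fintype.ofFinite (SimpleClass C)
  let N : Submodule ℤ ℝ := Submodule.span ℤ (Set.range fun i : SimpleClass C => fpDim i.obj)
  have hN : ∀ Y : C, fpDim Y ∈ N := fun Y => by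
    rw [(isAdditive_fpDim k).eq_sum k Y]
    exact Submodule.sum_mem _ fun i _ =>
      Submodule.smul_of_tower_mem N _ (Submodule.subset_span ⟨i, rfl⟩)
  refine isIntegral_of_smul_mem_submodule N ?_
    (Submodule.fg_span (Set.finite_range _)) _ fun y hy => ?_
  · intro h
    have h1 := hN (𝟙_ C)
    rw [h, Submodule.mem_bot] at h1
    exact (fpDim_pos k (Simple.not_isZero (𝟙_ C))).ne' h1
  · induction hy using Submodule.span_induction with
    | mem y hy =>
      obtain ⟨i, rfl⟩ := hy
      rw [smul_eq_mul, ← fpDim_tensor k]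
      exact hN _
    | zero => simp
    | add y z _ _ h1 h2 => rw [smul_add]; exact add_mem h1 h2
    | smul a y _ h1 => rw [smul_comm]; exact N.smul_mem a h1

end Integrality

theorem exists_int_eq_of_isIntegral_of_rat {x : ℝ} (hx : IsIntegral ℤ x) {q : ℚ} (hq : x = q) :
    ∃ n : ℤ, x = n := by
  subst hq
  have h1 : IsIntegral ℤ q :=
    (isIntegral_algebraMap_iff (B := ℝ) (algebraMap ℚ ℝ).injective).1 (by simpa using hx)
  obtain ⟨n, rfl⟩ := IsIntegrallyClosed.isIntegral_iff.1 h1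
  exact ⟨n, by simp⟩

section Freeness

variable (k : Type w) [Field k] [IsAlgClosed k]
  {C : Type u} [Category.{v} C] [Abelian C] [Linear k C] [MonoidalCategory C]
  [MonoidalPreadditive C] [MonoidalLinear k C] [RigidCategory C] [Simple (𝟙_ C)]
  [∀ X Y : C, FiniteDimensional k (X ⟶ Y)] [IsFiniteAbelian C]
  {D : Type u'} [Category.{v'} D] [Abelian D] [Linear k D] [MonoidalCategory D]
  [MonoidalPreadditive D] [MonoidalLinear k D] [RigidCategory D] [Simple (𝟙_ D)]
  [∀ X Y : D, FiniteDimensional k (X ⟶ Y)] [IsFiniteAbelian D]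
  {F : C ⥤ D}

omit [MonoidalLinear k C] [MonoidalLinear k D] [MonoidalPreadditive D] [RigidCategory D]
  [Simple (𝟙_ D)] [IsFiniteAbelian D] [MonoidalCategory D] in
theorem homDim_map_regularObj [Fintype (SimpleClass C)] [F.Additive]
    (hint : ∀ X : C, ∃ n : ℤ, fpDim X = n) (Y : D) :
    (homDim k (F.obj (regularObj C)) Y : ℝ) = regularPairing k F Y := by
  have h := ((isSplitAdditive_homDim k Y).comp_functor F).eq_sum k (regularObj C)
  rw [h, regularPairing]
  refine Finset.sum_congr rfl fun j _ => ?_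
  obtain ⟨n, hn⟩ := hint j.obj
  have h0 := fpDim_nonneg k j.obj
  rw [homDim_regularObj, nsmul_eq_mul, natCast_floor_eq_intCast_floor h0, hn, Int.floor_intCast]

include k in
theorem IsQuasiTensor.isFreeOfRank_map_regularObj (hF : IsQuasiTensor F) (hs : IsSurjective F)
    (hint : ∀ X : C, ∃ n : ℤ, fpDim X = n) :
    (∀ Y : D, ∃ n : ℤ, fpDim Y = n) ∧
      ∃ n : ℕ, catFPDim C / catFPDim D = n ∧ IsFreeOfRank (F.obj (regularObj C)) n := by
  have := Fintype.ofFinite (SimpleClass C)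
  have := Fintype.ofFinite (SimpleClass D)
  have := hF.additive
  -- As d₊(𝟙) = 1, pairing with the unit exhibits the ratio as the dimension of a vector space.
  set n := homDim k (F.obj (regularObj C)) (𝟙_ D) with hn
  have hpair := hF.regularPairing_eq k hs
  have hc : (∑ j : SimpleClass C, fpDim j.obj * fpDim (proj j)) /
      (∑ i : SimpleClass D, fpDim i.obj * fpDim (proj i)) = n := by
    rw [hn, homDim_map_regularObj k hint, hpair, fpDim_unit k, mul_one]
  have hn0 : (n : ℝ) ≠ 0 := by
    rw [← hc]
    exact (div_pos (sum_fpDim_mul_fpDim_proj_pos k C) (sum_fpDim_mul_fpDim_proj_pos k D)).ne'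
  simp_rw [hc] at hpair
  have hint' : ∀ Y : D, ∃ n : ℤ, fpDim Y = n := fun Y => by
    refine exists_int_eq_of_isIntegral_of_rat (isIntegral_fpDim k Y)
      (q := homDim k (F.obj (regularObj C)) Y / n) ?_
    push_cast
    rw [homDim_map_regularObj k hint, hpair, mul_div_cancel_left₀ _ hn0]
  refine ⟨hint', n, ?_, ?_⟩
  · rw [catFPDim_eq k, catFPDim_eq k, ← Complex.ofReal_div, hc, Complex.ofReal_natCast]
  · have h1 := hF.projective_map k hs (regularObj C) inferInstance
    have h2 : Projective (⨁ fun _ : Fin n => regularObj D) :=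
      projective_biproduct _ fun _ => inferInstance
    refine nonempty_iso_of_homDim_eq k _ _ fun i => ?_
    have h3 : (homDim k (F.obj (regularObj C)) i.obj : ℝ) = n * ⌊fpDim i.obj⌋₊ := by
      obtain ⟨m, hm⟩ := hint' i.obj
      rw [homDim_map_regularObj k hint, hpair,
        natCast_floor_eq_intCast_floor (fpDim_nonneg k i.obj), hm, Int.floor_intCast]
    rw [homDim_biproduct]
    simp only [homDim_regularObj, Finset.sum_const, Finset.card_univ, Fintype.card_fin,
      smul_eq_mul]
    exact_mod_cast h3

end Freeness

end FiniteTensor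

end

theorem mainTheorem2 (k : Type w) [Field k] [IsAlgClosed k]
    (C : Type u) [Category.{v} C] [Abelian C] [Linear k C] [MonoidalCategory C]
    [MonoidalPreadditive C] [MonoidalLinear k C] [RigidCategory C] [Simple (𝟙_ C)]
    [∀ X Y : C, FiniteDimensional k (X ⟶ Y)] [FiniteTensor.IsFiniteAbelian C]
    (D : Type u') [Category.{v'} D] [Abelian D] [Linear k D] [MonoidalCategory D]
    [MonoidalPreadditive D] [MonoidalLinear k D] [RigidCategory D] [Simple (𝟙_ D)]
    [∀ X Y : D, FiniteDimensional k (X ⟶ Y)] [FiniteTensor.IsFiniteAbelian D]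
    (F : C ⥤ D) (hF : FiniteTensor.IsQuasiTensor F) (hs : FiniteTensor.IsSurjective F) :
    ((∀ P : C, Projective P → Projective (F.obj P)) ∧
      FiniteTensor.catFPDim D ≠ 0 ∧
      FiniteTensor.mapVirtual F (FiniteTensor.regularVirtual C) =
        (FiniteTensor.catFPDim C / FiniteTensor.catFPDim D) • FiniteTensor.regularVirtual D) ∧
    ((∀ X : C, ∃ n : ℤ, FiniteTensor.fpDim X = n) →
      (∀ Y : D, ∃ n : ℤ, FiniteTensor.fpDim Y = n) ∧
      ∃ n : ℕ, FiniteTensor.catFPDim C / FiniteTensor.catFPDim D = n ∧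
        FiniteTensor.IsFreeOfRank (F.obj (FiniteTensor.regularObj C)) n) := by
  refine ⟨⟨hF.projective_map k hs, ?_, hF.mapVirtual_regularVirtual k hs⟩,
    hF.isFreeOfRank_map_regularObj k hs⟩
  have := Fintype.ofFinite (FiniteTensor.SimpleClass D)
  rw [FiniteTensor.catFPDim_eq k]
  exact_mod_cast (FiniteTensor.sum_fpDim_mul_fpDim_proj_pos k D).ne'
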